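/- All Hilbert spaces are complex and finite-dimensional. A *purified $\mathcal H$-channel* $[U,|\varepsilon\rangle,\mathcal E]$ consists of a Hilbert space $\mathcal E$, a unit vector $|\varepsilon\rangle\in\mathcal E$ and a unitary $U$ on $\mathcal H\otimes\mathcal E$. *PBS-diagrams* $D:n$ are built from the empty diagram ($:0$), the wire, the polarisation flip and gates ($:1$), the swap and the polarising beam splitter ($:2$) by sequential composition $D_2\circ D_1:n$ of $D_1,D_2:n$, parallel composition $D_1\oplus D_2:n_1+n_2$ and trace $Tr(D):n$ for $D:n+1$ (feedback of the last wire). A particle entering at position $p\in\{0,\dots,n-1\}$ with polarisation $c\in\{\rightarrow,\uparrow\}$ follows a path: the flip exchanges the polarisations, the swap exchanges positions $0$ and $1$, the beam splitter fixes the position of a particle with polarisation $\rightarrow$ and exchanges positions $0,1$ for $\uparrow$, and gates change neither. The path ends at some $(c',p')$, and $w_{c,p}$ denotes the word of gates crossed, each gate occurrence $a$ being a distinct letter. If every gate occurrence $a$ carries a purified $\mathcal H$-channel $[U_a,|\varepsilon_a\rangle,\mathcal E_a]$, let $V_a$ be $U_a$ extended by the identity to $\mathcal H\otimes\bigotimes_b\mathcal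 E_b$, let $V_\epsilon=I$, $V_{aw}=V_wV_a$, and let $U_D=\sum_{c,p}|c'\rangle\langle c|\otimes|p'\rangle\langle p|\otimes V_{w_{c,p}}$ and $|\varepsilon_D\rangle=\bigotimes_a|\varepsilon_a\rangle$. The semantics of $D$ is the superoperator $[\![D]\!]:\rho\mapsto \mathrm{Tr}_{\bigotimes_a\mathcal E_a}\big(U_D(\rho\otimes|\varepsilon_D\rangle\langle\varepsilon_D|)U_D^\dagger\big)$ on $\mathcal L(\mathbb C^{\{\rightarrow,\uparrow\}}\otimes\mathbb C^n\otimes\mathcal H)$. A *context* is such a diagram in which exactly one gate is left empty (the hole). Two purified $\mathcal H$-channels $P,Q$ satisfy $P\approx_2Q$ if $[\![C[P]]\!]=[\![C[Q]]\!]$ for all contexts $C[\cdot]:1$; $P\approx_1Q$ (resp. $P\approx_0Q$) if this holds for all such contexts without polarisation flips (resp. without beam splitters). Write $[U,|\varepsilon\rangle,\mathcal E]\triangleleft_{iso}[U',|\varepsilon'\rangle,\mathcal E']$ if there is an isometry $W:\mathcal E\to\mathcal E'$ with $W|\varepsilon\rangle=|\varepsilon'\rangle$ and $(I_{\mathcal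 H}\otimes W)U=U'(I_{\mathcal H}\otimes W)$, and let $\approx_{iso}$ be the symmetric and transitive closure of $\triangleleft_{iso}$. **Proposition.** For every nonzero Hilbert space $\mathcal H$, the relations $\approx_{iso},\approx_2,\approx_1,\approx_0$ on purified $\mathcal H$-channels are equivalence relations and $$\approx_{iso}\ \subsetneq\ \approx_2\ \subsetneq\ \approx_1\ \subsetneq\ \approx_0 .$$ Moreover, for the unitaries $X:|x\rangle\mapsto|x-1\bmod 3\rangle$ and $N:|x\rangle\mapsto(-1)^x|x\rangle$ on $\mathbb C^3$, the purified $\mathbb C$-channels $[X,|0\rangle,\mathbb C^3]$ and $[XN,|0\rangle,\mathbb C^3]$ (with $\mathbb C\otimes\mathbb C^3=\mathbb C^3$) satisfy $[X,|0\rangle,\mathbb C^3]\approx_2[XN,|0\rangle,\mathbb C^3]$ but not $[X,|0\rangle,\mathbb C^3]\approx_{iso}[XN,|0\rangle,\mathbb C^3]$. -/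

import Mathlib

open scoped TensorProduct

universe u v w

namespace PBS

noncomputable section

/-! ## Linear algebra on finite-dimensional Hilbert spaces -/

section LinearAlgebra

variable {K : Type*} [NormedAddCommGroup K] [InnerProductSpace ℂ K] [FiniteDimensional ℂ K]
variable {E : Type*} [NormedAddCommGroup E] [InnerProductSpace ℂ E] [FiniteDimensional ℂ E]
variable {F : Type*} [NormedAddCommGroup F] [InnerProductSpace ℂ F]

/-- The rank-one operator `|x⟩⟨y|`. -/
def ketbra (x : F) (y : E) : E →ₗ[ℂ] F :=
  (InnerProductSpace.rankOne ℂ x y).toLinearMap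

/-- The partial trace over the second tensor factor, `L(K ⊗ E) → L(K)`: the linear map
sending `A ⊗ B` to `Tr(B) A`. -/
def partialTrace : Module.End ℂ (K ⊗[ℂ] E) →ₗ[ℂ] Module.End ℂ K :=
  (TensorProduct.rid ℂ (Module.End ℂ K)).toLinearMap ∘ₗ
    (LinearMap.trace ℂ E).lTensor (Module.End ℂ K) ∘ₗ
      (homTensorHomEquiv ℂ K E K E).symm.toLinearMap

theorem partialTrace_map (A : Module.End ℂ K) (B : Module.End ℂ E) :
    partialTrace (TensorProduct.map A B) = LinearMap.trace ℂ E B • A := by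
  have h : (homTensorHomEquiv ℂ K E K E).symm (TensorProduct.map A B) = A ⊗ₜ[ℂ] B := by
    rw [LinearEquiv.symm_apply_eq, homTensorHomEquiv_apply]
    rfl
  simp [partialTrace, h]

/-- The superoperator `ρ ↦ Tr_E (U (ρ ⊗ |ε⟩⟨ε|) U†)` on `L(K)`. -/
def superoperator (U : Module.End ℂ (K ⊗[ℂ] E)) (ε : E) :
    Module.End ℂ K →ₗ[ℂ] Module.End ℂ K where
  toFun ρ := partialTrace (U * TensorProduct.map ρ (ketbra ε ε) * LinearMap.adjoint U)
  map_add' ρ σ := by simp [TensorProduct.map_add_left, mul_add, add_mul]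
  map_smul' r ρ := by simp [TensorProduct.map_smul_left]

end LinearAlgebra

/-! ## Purified channels -/

/-- A purified `H`-channel `[U, |ε⟩, E]`: an environment Hilbert space `E`, a (normalised)
initial state `ε` of the environment, and a unitary `U` on `H ⊗ E`. -/
structure PurifiedChannel (H : Type u) [NormedAddCommGroup H] [InnerProductSpace ℂ H] :
    Type (max u (v + 1)) where
  E : Type v
  [normedE : NormedAddCommGroup E]
  [innerE : InnerProductSpace ℂ E]
  [finiteE : FiniteDimensional ℂ E]
  ε : E
  norm_ε : ‖ε‖ = 1
  U : (H ⊗[ℂ] E) ≃ₗᵢ[ℂ] (H ⊗[ℂ] E)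

attribute [instance] PurifiedChannel.normedE PurifiedChannel.innerE PurifiedChannel.finiteE

/-! ## The global environment -/

section GlobalEnv

variable {ι : Type w} (E : ι → Type v) [∀ i, NormedAddCommGroup (E i)]
  [∀ i, InnerProductSpace ℂ (E i)] [∀ i, FiniteDimensional ℂ (E i)]

/-- The Hilbert space `⨂ i, E i`. It is a copy of Mathlib's `⨂[ℂ] i, E i`, which carries the
projective norm and not the Hilbert space norm. -/
def GlobalEnv : Type (max w v) := ⨂[ℂ] i, E i

instance : AddCommGroup (GlobalEnv E) := inferInstanceAs (AddCommGroup (⨂[ℂ] i, E i))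
instance : Module ℂ (GlobalEnv E) := inferInstanceAs (Module ℂ (⨂[ℂ] i, E i))
instance [Finite ι] : FiniteDimensional ℂ (GlobalEnv E) :=
  inferInstanceAs (Module.Finite ℂ (⨂[ℂ] i, E i))

/-- The identification of the algebraic tensor product with the Hilbert space. -/
def GlobalEnv.equiv : (⨂[ℂ] i, E i) ≃ₗ[ℂ] GlobalEnv E := LinearEquiv.refl ℂ _

variable {E} in
/-- The product vector `⨂ i, x i`. -/
def GlobalEnv.tprod (x : ∀ i, E i) : GlobalEnv E :=
  GlobalEnv.equiv E (PiTensorProduct.tprod ℂ x)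

/-- The basis of the tensor product made of products of vectors of orthonormal bases. -/
def GlobalEnv.basis [Finite ι] :
    Module.Basis (∀ i, Fin (Module.finrank ℂ (E i))) ℂ (GlobalEnv E) :=
  (Basis.piTensorProduct fun i => (stdOrthonormalBasis ℂ (E i)).toBasis).map (GlobalEnv.equiv E)

/-- Coordinates in `GlobalEnv.basis`. -/
def GlobalEnv.coords [Finite ι] (x : GlobalEnv E) :
    EuclideanSpace ℂ (∀ i, Fin (Module.finrank ℂ (E i))) :=
  WithLp.toLp 2 fun p => (GlobalEnv.basis E).repr x p

open scoped Classical in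
/-- The inner product for which the product basis is orthonormal; `GlobalEnv.inner_tprod` below
says that `⟪⨂ x i, ⨂ y i⟫ = ∏ ⟪x i, y i⟫`, so it is the tensor product Hilbert space structure. -/
@[reducible]
def GlobalEnv.core [Finite ι] : InnerProductSpace.Core ℂ (GlobalEnv E) :=
  letI : Fintype ι := Fintype.ofFinite ι
  { inner := fun x y => inner ℂ (GlobalEnv.coords E x) (GlobalEnv.coords E y)
    conj_inner_symm := fun x y => inner_conj_symm _ _
    re_inner_nonneg := fun x => inner_self_nonneg
    add_left := fun x y z => by
      rw [← inner_add_left]; congr 1; ext p; simp [GlobalEnv.coords]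
    smul_left := fun x y r => by
      rw [← inner_smul_left]; congr 1; ext p; simp [GlobalEnv.coords]
    definite := fun x hx => by
      have h := inner_self_eq_zero.mp hx
      apply (GlobalEnv.basis E).ext_elem
      intro p
      have := congrArg (fun z => z p) h
      simpa [GlobalEnv.coords] using this }

instance [Finite ι] : NormedAddCommGroup (GlobalEnv E) := (GlobalEnv.core E).toNormedAddCommGroup
instance [Finite ι] : InnerProductSpace ℂ (GlobalEnv E) := InnerProductSpace.ofCore (GlobalEnv.core E).toCore

theorem GlobalEnv.inner_tprod [Fintype ι] (x y : ∀ i, E i) :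
    inner ℂ (GlobalEnv.tprod x) (GlobalEnv.tprod y) = ∏ i, inner ℂ (x i) (y i) := by
  classical
  rw [show (∏ i, inner ℂ (x i) (y i)) =
    (let _ : Fintype ι := Fintype.ofFinite ι; ∏ i, inner ℂ (x i) (y i)) by congr!]
  let _ : Fintype ι := Fintype.ofFinite ι
  have hc : ∀ (z : ∀ i, E i) p, GlobalEnv.coords E (GlobalEnv.tprod z) p =
      ∏ i, (stdOrthonormalBasis ℂ (E i)).repr (z i) (p i) := fun z p => by
    simp [GlobalEnv.coords, GlobalEnv.basis, GlobalEnv.tprod]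
  have h0 : inner ℂ (GlobalEnv.tprod x) (GlobalEnv.tprod y) =
      ∑ p, inner ℂ (GlobalEnv.coords E (GlobalEnv.tprod x) p)
        (GlobalEnv.coords E (GlobalEnv.tprod y) p) := by
    have h1 : inner ℂ (GlobalEnv.tprod x) (GlobalEnv.tprod y) =
        inner ℂ (GlobalEnv.coords E (GlobalEnv.tprod x))
          (GlobalEnv.coords E (GlobalEnv.tprod y)) := rfl
    rw [h1, PiLp.inner_apply]
  have h2 : ∀ i, inner ℂ (x i) (y i) = ∑ j,
      inner ℂ ((stdOrthonormalBasis ℂ (E i)).repr (x i) j)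
        ((stdOrthonormalBasis ℂ (E i)).repr (y i) j) := fun i => by
    rw [← PiLp.inner_apply, LinearIsometryEquiv.inner_map_map]
  rw [h0]
  simp only [h2, hc]
  rw [Finset.prod_univ_sum, Fintype.piFinset_univ]
  refine Finset.sum_congr rfl fun p _ => ?_
  simp [Finset.prod_mul_distrib]

variable (H : Type u) [NormedAddCommGroup H] [InnerProductSpace ℂ H] [FiniteDimensional ℂ H]

open scoped Classical in
/-- The operator on `H ⊗ ⨂ i, E i` acting as `X` on `H ⊗ E a` and as the identity on the
other factors: the linear extension of `A ⊗ B ↦ A ⊗ (B on E a, identity elsewhere)`. -/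
def gateOp (a : ι) :
    Module.End ℂ (H ⊗[ℂ] E a) →ₗ[ℂ] Module.End ℂ (H ⊗[ℂ] GlobalEnv E) :=
  TensorProduct.homTensorHomMap (RingHom.id ℂ) H (GlobalEnv E) H (GlobalEnv E) ∘ₗ
    LinearMap.lTensor (Module.End ℂ H)
      ((GlobalEnv.equiv E).conj.toLinearMap ∘ₗ
        (PiTensorProduct.mapMultilinear ℂ E E).toLinearMap (fun _ => LinearMap.id) a) ∘ₗ
      (homTensorHomEquiv ℂ H (E a) H (E a)).symm.toLinearMap

variable {E H} in
open scoped Classical in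
theorem gateOp_map_tprod (a : ι) (A : Module.End ℂ H) (B : Module.End ℂ (E a)) (h : H)
    (x : ∀ i, E i) :
    gateOp E H a (TensorProduct.map A B) (h ⊗ₜ[ℂ] GlobalEnv.tprod x) =
      A h ⊗ₜ[ℂ] GlobalEnv.tprod (Function.update x a (B (x a))) := by
  have hs : (homTensorHomEquiv ℂ H (E a) H (E a)).symm (TensorProduct.map A B) =
      A ⊗ₜ[ℂ] B := by
    rw [LinearEquiv.symm_apply_eq, homTensorHomEquiv_apply]
    rfl
  simp [gateOp, hs, GlobalEnv.tprod, LinearEquiv.conj_apply]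
  congr 3
  funext i
  by_cases hi : i = a
  · subst hi; simp
  · simp [hi]

end GlobalEnv

/-! ## Diagrams and word path semantics -/

/-- Polarisations: `hor` is `→`, `ver` is `↑`. -/
inductive Pol : Type
  | hor : Pol
  | ver : Pol
  deriving DecidableEq

instance : Fintype Pol where
  elems := {.hor, .ver}
  complete c := by cases c <;> simp

/-- The polarisation flip. -/
def Pol.flip : Pol → Pol
  | .hor => .ver
  | .ver => .hor

/-- PBS-diagrams `D : n` whose gates carry elements of `Λ`: the empty diagram, the wire, the
polarisation flip, the swap, the polarising beam splitter, gates, sequential composition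
`D₂ ∘ D₁`, parallel composition `D₁ ⊕ D₂` and trace. -/
inductive Diagram (Λ : Type w) : ℕ → Type w
  | empty : Diagram Λ 0
  | wire : Diagram Λ 1
  | neg : Diagram Λ 1
  | swap : Diagram Λ 2
  | pbs : Diagram Λ 2
  | gate (a : Λ) : Diagram Λ 1
  | comp {n : ℕ} (D₂ D₁ : Diagram Λ n) : Diagram Λ n
  | par {n m : ℕ} (D₁ : Diagram Λ n) (D₂ : Diagram Λ m) : Diagram Λ (n + m)
  | tr {n : ℕ} (D : Diagram Λ (n + 1)) : Diagram Λ n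

namespace Diagram

variable {Λ : Type w}

/-- The word path semantics `(D, c, p) ⇒ʷ (c', p')`. A horizontal particle is reflected by a
beam splitter (and stays at its position), a vertical one is transmitted. The traced wire is the
last one, and it is used at most twice. -/
def Path : {n : ℕ} → Diagram Λ n → Pol × Fin n → List Λ → Pol × Fin n → Prop
  | _, .empty, _, _, _ => False
  | _, .wire, s, word, s' => word = [] ∧ s' = s
  | _, .neg, s, word, s' => word = [] ∧ s' = (s.1.flip, s.2)
  | _, .swap, s, word, s' => word = [] ∧ s' = (s.1, s.2.rev)
  | _, .pbs, s, word, s' =>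
      word = [] ∧ s' = (match s with
        | (.hor, p) => (.hor, p)
        | (.ver, p) => (.ver, p.rev))
  | _, .gate a, s, word, s' => word = [a] ∧ s' = s
  | _, .comp D₂ D₁, s, word, s' =>
      ∃ w₁ t w₂, Path D₁ s w₁ t ∧ Path D₂ t w₂ s' ∧ word = w₁ ++ w₂
  | _, @Diagram.par _ n m D₁ D₂, s, word, s' =>
      (∃ p p' : Fin n, s.2 = p.castAdd m ∧ s'.2 = p'.castAdd m ∧
        Path D₁ (s.1, p) word (s'.1, p')) ∨
      (∃ p p' : Fin m, s.2 = p.natAdd n ∧ s'.2 = p'.natAdd n ∧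
        Path D₂ (s.1, p) word (s'.1, p'))
  | _, @Diagram.tr _ n D, s, word, s' =>
      Path D (s.1, s.2.castSucc) word (s'.1, s'.2.castSucc) ∨
      (∃ w₀ c₁ w₁, Path D (s.1, s.2.castSucc) w₀ (c₁, Fin.last n) ∧
        Path D (c₁, Fin.last n) w₁ (s'.1, s'.2.castSucc) ∧ word = w₀ ++ w₁) ∨
      (∃ w₀ c₁ w₁ c₂ w₂, Path D (s.1, s.2.castSucc) w₀ (c₁, Fin.last n) ∧
        Path D (c₁, Fin.last n) w₁ (c₂, Fin.last n) ∧
        Path D (c₂, Fin.last n) w₂ (s'.1, s'.2.castSucc) ∧ word = w₀ ++ w₁ ++ w₂)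

/-- The word path semantics is functional, injective and total. -/
theorem Path.main {n : ℕ} (D : Diagram Λ n) :
    (∀ s w₁ t₁ w₂ t₂, Path D s w₁ t₁ → Path D s w₂ t₂ → w₁ = w₂ ∧ t₁ = t₂) ∧
    (∀ s₁ s₂ w₁ w₂ t, Path D s₁ w₁ t → Path D s₂ w₂ t → s₁ = s₂) ∧
    (∀ s, ∃ word t, Path D s word t) := by
  have h01 : ∀ p : Fin 2, p.rev.rev = p := Fin.rev_rev
  induction D with
  | empty => exact ⟨fun s => s.2.elim0, fun s => s.2.elim0, fun s => s.2.elim0⟩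
  | wire =>
    refine ⟨?_, ?_, fun s => ⟨[], s, rfl, rfl⟩⟩
    · rintro s w₁ t₁ w₂ t₂ ⟨rfl, rfl⟩ ⟨rfl, rfl⟩; exact ⟨rfl, rfl⟩
    · rintro s₁ s₂ w₁ w₂ t ⟨rfl, rfl⟩ ⟨rfl, h⟩; exact h
  | neg =>
    refine ⟨?_, ?_, fun s => ⟨[], _, rfl, rfl⟩⟩
    · rintro s w₁ t₁ w₂ t₂ ⟨rfl, rfl⟩ ⟨rfl, rfl⟩; exact ⟨rfl, rfl⟩
    · rintro ⟨c, p⟩ ⟨c', p'⟩ w₁ w₂ t ⟨rfl, rfl⟩ ⟨rfl, h⟩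
      cases c <;> cases c' <;> simp_all [Pol.flip]
  | swap =>
    refine ⟨?_, ?_, fun s => ⟨[], _, rfl, rfl⟩⟩
    · rintro s w₁ t₁ w₂ t₂ ⟨rfl, rfl⟩ ⟨rfl, rfl⟩; exact ⟨rfl, rfl⟩
    · rintro ⟨c, p⟩ ⟨c', p'⟩ w₁ w₂ t ⟨rfl, rfl⟩ ⟨rfl, h⟩
      grind
  | pbs =>
    refine ⟨?_, ?_, fun s => ⟨[], _, rfl, rfl⟩⟩
    · rintro s w₁ t₁ w₂ t₂ ⟨rfl, rfl⟩ ⟨rfl, rfl⟩; exact ⟨rfl, rfl⟩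
    · rintro ⟨c, p⟩ ⟨c', p'⟩ w₁ w₂ t ⟨rfl, rfl⟩ ⟨rfl, h⟩
      cases c <;> cases c' <;> grind
  | gate a =>
    refine ⟨?_, ?_, fun s => ⟨_, s, rfl, rfl⟩⟩
    · rintro s w₁ t₁ w₂ t₂ ⟨rfl, rfl⟩ ⟨rfl, rfl⟩; exact ⟨rfl, rfl⟩
    · rintro s₁ s₂ w₁ w₂ t ⟨rfl, rfl⟩ ⟨rfl, h⟩; exact h
  | comp D₂ D₁ ih₂ ih₁ =>
    obtain ⟨f₁, i₁, e₁⟩ := ih₁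
    obtain ⟨f₂, i₂, e₂⟩ := ih₂
    refine ⟨?_, ?_, ?_⟩
    · rintro s _ t₁ _ t₂ ⟨u, t, v, h, h', rfl⟩ ⟨u', t', v', k, k', rfl⟩
      obtain ⟨rfl, rfl⟩ := f₁ _ _ _ _ _ h k
      obtain ⟨rfl, rfl⟩ := f₂ _ _ _ _ _ h' k'
      exact ⟨rfl, rfl⟩
    · rintro s₁ s₂ _ _ t ⟨u, x, v, h, h', rfl⟩ ⟨u', x', v', k, k', rfl⟩
      obtain rfl := i₂ _ _ _ _ _ h' k'
      exact i₁ _ _ _ _ _ h k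
    · intro s
      obtain ⟨w₁, t, h⟩ := e₁ s
      obtain ⟨w₂, t', h'⟩ := e₂ t
      exact ⟨_, _, _, _, _, h, h', rfl⟩
  | @par n m D₁ D₂ ih₁ ih₂ =>
    obtain ⟨f₁, i₁, e₁⟩ := ih₁
    obtain ⟨f₂, i₂, e₂⟩ := ih₂
    have hne : ∀ (p : Fin n) (q : Fin m), p.castAdd m ≠ q.natAdd n := fun p q h => by
      have := congrArg Fin.val h
      simp at this
      omega
    have hl : ∀ (p q : Fin n), p.castAdd m = q.castAdd m → p = q := fun p q h => by
      simpa using h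
    have hr : ∀ (p q : Fin m), p.natAdd n = q.natAdd n → p = q := fun p q h => by
      simpa using h
    refine ⟨?_, ?_, ?_⟩
    · rintro ⟨c, x⟩ w₁ ⟨c₁, y₁⟩ w₂ ⟨c₂, y₂⟩ (⟨p, p', hp, hp', h⟩ | ⟨p, p', hp, hp', h⟩)
        (⟨q, q', hq, hq', k⟩ | ⟨q, q', hq, hq', k⟩)
      · obtain rfl := hl _ _ (hp.symm.trans hq)
        have := f₁ _ _ _ _ _ h k
        grind
      · exact (hne _ _ (hp.symm.trans hq)).elim
      · exact (hne _ _ (hq.symm.trans hp)).elim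
      · obtain rfl := hr _ _ (hp.symm.trans hq)
        have := f₂ _ _ _ _ _ h k
        grind
    · rintro ⟨c₁, x₁⟩ ⟨c₂, x₂⟩ w₁ w₂ ⟨d, y⟩ (⟨p, p', hp, hp', h⟩ | ⟨p, p', hp, hp', h⟩)
        (⟨q, q', hq, hq', k⟩ | ⟨q, q', hq, hq', k⟩)
      · obtain rfl := hl _ _ (hp'.symm.trans hq')
        have := i₁ _ _ _ _ _ h k
        grind
      · exact (hne _ _ (hp'.symm.trans hq')).elim
      · exact (hne _ _ (hq'.symm.trans hp')).elim
      · obtain rfl := hr _ _ (hp'.symm.trans hq')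
        have := i₂ _ _ _ _ _ h k
        grind
    · rintro ⟨c, x⟩
      induction x using Fin.addCases with
      | left p =>
        obtain ⟨w₁, ⟨c', p'⟩, h⟩ := e₁ (c, p)
        exact ⟨w₁, (c', p'.castAdd m), Or.inl ⟨p, p', rfl, rfl, h⟩⟩
      | right p =>
        obtain ⟨w₁, ⟨c', p'⟩, h⟩ := e₂ (c, p)
        exact ⟨w₁, (c', p'.natAdd n), Or.inr ⟨p, p', rfl, rfl, h⟩⟩
  | @tr n D ih =>
    obtain ⟨f, i, e⟩ := ih
    have hne : ∀ p : Fin n, p.castSucc ≠ Fin.last n := fun p => Fin.castSucc_ne_last p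
    have hc : ∀ p q : Fin n, p.castSucc = q.castSucc → p = q := fun p q h => by simpa using h
    have hcase : ∀ x : Fin (n + 1), x = Fin.last n ∨ ∃ y : Fin n, x = y.castSucc := fun x => by
      induction x using Fin.lastCases with
      | last => exact Or.inl rfl
      | cast y => exact Or.inr ⟨y, rfl⟩
    refine ⟨?_, ?_, ?_⟩
    · rintro ⟨c, x⟩ w₁ ⟨c₁, y₁⟩ w₂ ⟨c₂, y₂⟩ h k
      simp only [Path] at h k
      grind
    · rintro ⟨c₁, x₁⟩ ⟨c₂, x₂⟩ w₁ w₂ ⟨d, y⟩ h k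
      simp only [Path] at h k
      grind
    · rintro ⟨c, x⟩
      obtain ⟨w₀, ⟨c₁, y₁⟩, h₀⟩ := e (c, x.castSucc)
      rcases hcase y₁ with rfl | ⟨z, rfl⟩
      swap
      · exact ⟨w₀, (c₁, z), Or.inl h₀⟩
      obtain ⟨w₁, ⟨c₂, y₂⟩, h₁⟩ := e (c₁, Fin.last n)
      rcases hcase y₂ with rfl | ⟨z, rfl⟩
      swap
      · exact ⟨_, (c₂, z), Or.inr (Or.inl ⟨_, _, _, h₀, h₁, rfl⟩)⟩
      obtain ⟨w₂, ⟨c₃, y₃⟩, h₂⟩ := e (c₂, Fin.last n)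
      rcases hcase y₃ with rfl | ⟨z, rfl⟩
      swap
      · exact ⟨_, (c₃, z), Or.inr (Or.inr ⟨_, _, _, _, _, h₀, h₁, h₂, rfl⟩)⟩
      exfalso
      have h12 : c₁ ≠ c₂ := by
        rintro rfl
        exact hne x (congrArg Prod.snd (i _ _ _ _ _ h₀ h₁))
      have h13 : c₁ ≠ c₃ := by
        rintro rfl
        exact hne x (congrArg Prod.snd (i _ _ _ _ _ h₀ h₂))
      have h23 : c₂ ≠ c₃ := by
        rintro rfl
        exact h12 (congrArg Prod.fst (i _ _ _ _ _ h₁ h₂))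
      cases c₁ <;> cases c₂ <;> cases c₃ <;>
        first | exact h12 rfl | exact h13 rfl | exact h23 rfl

theorem exists_path {n : ℕ} (D : Diagram Λ n) (s : Pol × Fin n) :
    ∃ r : List Λ × (Pol × Fin n), Path D s r.1 r.2 := by
  obtain ⟨word, t, h⟩ := (Path.main D).2.2 s
  exact ⟨(word, t), h⟩

/-- The word `w^D_{c,p}`. -/
def word {n : ℕ} (D : Diagram Λ n) (s : Pol × Fin n) : List Λ :=
  (exists_path D s).choose.1

/-- The final polarisation and position `(c^D_{c,p}, p^D_{c,p})`. -/
def target {n : ℕ} (D : Diagram Λ n) (s : Pol × Fin n) : Pol × Fin n :=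
  (exists_path D s).choose.2

theorem path_iff {n : ℕ} (D : Diagram Λ n) (s : Pol × Fin n) (x : List Λ) (t : Pol × Fin n) :
    Path D s x t ↔ x = D.word s ∧ t = D.target s := by
  constructor
  · exact fun h => (Path.main D).1 _ _ _ _ _ h (exists_path D s).choose_spec
  · rintro ⟨rfl, rfl⟩
    exact (exists_path D s).choose_spec

/-- No beam splitter occurs in the diagram. -/
def PBSFree : {n : ℕ} → Diagram Λ n → Prop
  | _, .pbs => False
  | _, .comp D₂ D₁ => PBSFree D₂ ∧ PBSFree D₁
  | _, .par D₁ D₂ => PBSFree D₁ ∧ PBSFree D₂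
  | _, .tr D => PBSFree D
  | _, _ => True

/-- No polarisation flip occurs in the diagram. -/
def NegFree : {n : ℕ} → Diagram Λ n → Prop
  | _, .neg => False
  | _, .comp D₂ D₁ => NegFree D₂ ∧ NegFree D₁
  | _, .par D₁ D₂ => NegFree D₁ ∧ NegFree D₂
  | _, .tr D => NegFree D
  | _, _ => True

/-- Relabelling of the gates. -/
def map {Λ' : Type v} (f : Λ → Λ') : {n : ℕ} → Diagram Λ n → Diagram Λ' n
  | _, .empty => .empty
  | _, .wire => .wire
  | _, .neg => .neg
  | _, .swap => .swap
  | _, .pbs => .pbs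
  | _, .gate a => .gate (f a)
  | _, .comp D₂ D₁ => .comp (map f D₂) (map f D₁)
  | _, .par D₁ D₂ => .par (map f D₁) (map f D₂)
  | _, .tr D => .tr (map f D)

/-- The set of gate occurrences of a diagram. -/
def Pos : {n : ℕ} → Diagram Λ n → Type
  | _, .gate _ => Unit
  | _, .comp D₂ D₁ => Pos D₂ ⊕ Pos D₁
  | _, .par D₁ D₂ => Pos D₁ ⊕ Pos D₂
  | _, .tr D => Pos D
  | _, _ => Empty

instance finite_pos {n : ℕ} (D : Diagram Λ n) : Finite D.Pos := by
  induction D with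
  | gate a => exact inferInstanceAs (Finite Unit)
  | comp D₂ D₁ ih₂ ih₁ => exact inferInstanceAs (Finite (D₂.Pos ⊕ D₁.Pos))
  | par D₁ D₂ ih₁ ih₂ => exact inferInstanceAs (Finite (D₁.Pos ⊕ D₂.Pos))
  | tr D ih => exact ih
  | empty => exact inferInstanceAs (Finite Empty)
  | wire => exact inferInstanceAs (Finite Empty)
  | neg => exact inferInstanceAs (Finite Empty)
  | swap => exact inferInstanceAs (Finite Empty)
  | pbs => exact inferInstanceAs (Finite Empty)

/-- What the gate at a given occurrence carries. -/
def label : {n : ℕ} → (D : Diagram Λ n) → D.Pos → Λ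
  | _, .gate a => fun _ => a
  | _, .comp D₂ D₁ => Sum.elim (label D₂) (label D₁)
  | _, .par D₁ D₂ => Sum.elim (label D₁) (label D₂)
  | _, .tr D => label D
  | _, .empty => Empty.elim
  | _, .wire => Empty.elim
  | _, .neg => Empty.elim
  | _, .swap => Empty.elim
  | _, .pbs => Empty.elim

/-- The underlying bare diagram: every gate is labelled by its own occurrence, so that the gate
labels are pairwise distinct. -/
def bare : {n : ℕ} → (D : Diagram Λ n) → Diagram D.Pos n
  | _, .gate _ => .gate ()
  | _, .comp D₂ D₁ => .comp ((bare D₂).map Sum.inl) ((bare D₁).map Sum.inr)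
  | _, .par D₁ D₂ => .par ((bare D₁).map Sum.inl) ((bare D₂).map Sum.inr)
  | _, .tr D => .tr (bare D)
  | _, .empty => .empty
  | _, .wire => .wire
  | _, .neg => .neg
  | _, .swap => .swap
  | _, .pbs => .pbs

theorem map_map {Λ' : Type v} {Λ'' : Type u} (f : Λ → Λ') (g : Λ' → Λ'') {n : ℕ}
    (D : Diagram Λ n) : (D.map f).map g = D.map (g ∘ f) := by
  induction D <;> simp_all [map]

/-- Filling the gates of the underlying bare diagram gives back the diagram. -/
theorem bare_map_label {n : ℕ} (D : Diagram Λ n) : D.bare.map D.label = D := by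
  induction D with
  | comp D₂ D₁ ih₂ ih₁ =>
    exact congrArg₂ Diagram.comp ((map_map _ _ _).trans ih₂) ((map_map _ _ _).trans ih₁)
  | par D₁ D₂ ih₁ ih₂ =>
    exact congrArg₂ Diagram.par ((map_map _ _ _).trans ih₁) ((map_map _ _ _).trans ih₂)
  | tr D ih => exact congrArg Diagram.tr ih
  | _ => rfl

end Diagram

/-! ## Quantum semantics -/

section Semantics

variable {H : Type u} [NormedAddCommGroup H] [InnerProductSpace ℂ H] [FiniteDimensional ℂ H]

/-- The state space `ℂ^{→,↑} ⊗ ℂ^n ⊗ H` of the particle. -/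
abbrev Particle (H : Type u) [NormedAddCommGroup H] [InnerProductSpace ℂ H] (n : ℕ) : Type u :=
  EuclideanSpace ℂ Pol ⊗[ℂ] (EuclideanSpace ℂ (Fin n) ⊗[ℂ] H)

/-- The global environment `⨂ a, E a` of a family of purified channels. -/
abbrev Env {ι : Type w} (G : ι → PurifiedChannel.{u, v} H) : Type (max w v) :=
  GlobalEnv fun a => (G a).E

/-- The initial state `⨂ a, |ε a⟩` of the global environment. -/
def envState {ι : Type w} (G : ι → PurifiedChannel.{u, v} H) : Env G :=
  GlobalEnv.tprod fun a => (G a).ε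

/-- The operator `V_w` on `H ⊗ Env G` for a word `w`, with `V_{aw} = V_w V_a`. -/
def wordOp {ι : Type w} (G : ι → PurifiedChannel.{u, v} H) :
    List ι → Module.End ℂ (H ⊗[ℂ] Env G)
  | [] => 1
  | a :: x => wordOp G x *
      gateOp (fun b => (G b).E) H a (G a).U.toLinearEquiv.toLinearMap

/-- The operator `∑_{c,p} |c'⟩⟨c| ⊗ |p'⟩⟨p| ⊗ V_w` on the particle and the global environment,
where `(D, c, p) ⇒ʷ (c', p')`. -/
def diagramOp {ι : Type w} {n : ℕ} (D : Diagram ι n) (G : ι → PurifiedChannel.{u, v} H) :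
    Module.End ℂ (Particle H n ⊗[ℂ] Env G) :=
  let e : Particle H n ⊗[ℂ] Env G ≃ₗ[ℂ]
      EuclideanSpace ℂ Pol ⊗[ℂ] (EuclideanSpace ℂ (Fin n) ⊗[ℂ] (H ⊗[ℂ] Env G)) :=
    (TensorProduct.assoc ℂ _ _ _).trans
      (TensorProduct.congr (LinearEquiv.refl ℂ _) (TensorProduct.assoc ℂ _ _ _))
  e.symm.conj (∑ s : Pol × Fin n,
    TensorProduct.map
      (ketbra (EuclideanSpace.single (D.target s).1 (1 : ℂ)) (EuclideanSpace.single s.1 (1 : ℂ)))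
      (TensorProduct.map
        (ketbra (EuclideanSpace.single (D.target s).2 (1 : ℂ))
          (EuclideanSpace.single s.2 (1 : ℂ)))
        (wordOp G (D.word s))))

/-- The quantum semantics `⟦D⟧` of an extended PBS-diagram, i.e. of a diagram whose gates are
purified channels: the superoperator on the particle obtained by tracing out the global
environment. -/
def semantics {n : ℕ} (D : Diagram (PurifiedChannel.{u, v} H) n) :
    Module.End ℂ (Particle H n) →ₗ[ℂ] Module.End ℂ (Particle H n) :=
  superoperator (K := Particle H n) (E := Env D.label)
    (diagramOp D.bare D.label) (envState D.label)

end Semantics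

/-! ## Contexts and observational equivalences -/

/-- Contexts: diagrams with gates in `Λ` and exactly one hole. -/
inductive Context (Λ : Type w) : ℕ → Type w
  | hole : Context Λ 1
  | compLeft {n : ℕ} (D : Diagram Λ n) (C : Context Λ n) : Context Λ n
  | compRight {n : ℕ} (C : Context Λ n) (D : Diagram Λ n) : Context Λ n
  | parLeft {m n : ℕ} (D : Diagram Λ m) (C : Context Λ n) : Context Λ (m + n)
  | parRight {n m : ℕ} (C : Context Λ n) (D : Diagram Λ m) : Context Λ (n + m)
  | tr {n : ℕ} (C : Context Λ (n + 1)) : Context Λ n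

namespace Context

variable {Λ : Type w}

/-- Filling the hole of a context. -/
def subst (a : Λ) : {n : ℕ} → Context Λ n → Diagram Λ n
  | _, .hole => .gate a
  | _, .compLeft D C => .comp D (subst a C)
  | _, .compRight C D => .comp (subst a C) D
  | _, .parLeft D C => .par D (subst a C)
  | _, .parRight C D => .par (subst a C) D
  | _, .tr C => .tr (subst a C)

/-- No beam splitter occurs in the context. -/
def PBSFree : {n : ℕ} → Context Λ n → Prop
  | _, .hole => True
  | _, .compLeft D C => D.PBSFree ∧ PBSFree C
  | _, .compRight C D => PBSFree C ∧ D.PBSFree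
  | _, .parLeft D C => D.PBSFree ∧ PBSFree C
  | _, .parRight C D => PBSFree C ∧ D.PBSFree
  | _, .tr C => PBSFree C

/-- No polarisation flip occurs in the context. -/
def NegFree : {n : ℕ} → Context Λ n → Prop
  | _, .hole => True
  | _, .compLeft D C => D.NegFree ∧ NegFree C
  | _, .compRight C D => NegFree C ∧ D.NegFree
  | _, .parLeft D C => D.NegFree ∧ NegFree C
  | _, .parRight C D => NegFree C ∧ D.NegFree
  | _, .tr C => NegFree C

end Context

section Equivalences

variable {H : Type u} [NormedAddCommGroup H] [InnerProductSpace ℂ H]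

/-- `≈₀`: indistinguishability by contexts with one input/output wire and no beam splitter. -/
def ObsEquiv₀ [FiniteDimensional ℂ H] (P Q : PurifiedChannel.{u, v} H) : Prop :=
  ∀ C : Context (PurifiedChannel.{u, v} H) 1, C.PBSFree →
    semantics (C.subst P) = semantics (C.subst Q)

/-- `≈₁`: indistinguishability by contexts with one input/output wire and no polarisation
flip. -/
def ObsEquiv₁ [FiniteDimensional ℂ H] (P Q : PurifiedChannel.{u, v} H) : Prop :=
  ∀ C : Context (PurifiedChannel.{u, v} H) 1, C.NegFree →
    semantics (C.subst P) = semantics (C.subst Q)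

/-- `≈₂`: indistinguishability by all contexts with one input/output wire. -/
def ObsEquiv₂ [FiniteDimensional ℂ H] (P Q : PurifiedChannel.{u, v} H) : Prop :=
  ∀ C : Context (PurifiedChannel.{u, v} H) 1,
    semantics (C.subst P) = semantics (C.subst Q)

/-- The isometry preorder: there is an isometry `W : E → E'` with `W|ε⟩ = |ε'⟩` and
`(I ⊗ W) U = U' (I ⊗ W)`. -/
def IsoLE (P Q : PurifiedChannel.{u, v} H) : Prop :=
  ∃ W : P.E →ₗᵢ[ℂ] Q.E, W P.ε = Q.ε ∧
    ∀ x : H ⊗[ℂ] P.E, W.lTensor H (P.U x) = Q.U (W.lTensor H x)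

/-- `≈_iso`: the symmetric and transitive closure of the isometry preorder. -/
def IsoEquiv (P Q : PurifiedChannel.{u, v} H) : Prop :=
  Relation.TransGen (Relation.SymmGen IsoLE) P Q

end Equivalences

/-! ## The two qutrit channels -/

/-- The basis vector `|x⟩` of `ℂ³`. -/
def ket (x : Fin 3) : EuclideanSpace ℂ (Fin 3) := EuclideanSpace.single x 1

/-- `X : |x⟩ ↦ |x - 1 mod 3⟩`. -/
def opX : EuclideanSpace ℂ (Fin 3) ≃ₗᵢ[ℂ] EuclideanSpace ℂ (Fin 3) :=
  LinearIsometryEquiv.piLpCongrLeft 2 ℂ ℂ (Equiv.subRight 1)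

/-- `N : |x⟩ ↦ (-1)^x |x⟩`. -/
def opN : EuclideanSpace ℂ (Fin 3) ≃ₗᵢ[ℂ] EuclideanSpace ℂ (Fin 3) :=
  LinearIsometryEquiv.piLpCongrRight 2 fun x => LinearIsometryEquiv.neg ℂ ^ (x : ℕ)

theorem opX_ket (x : Fin 3) : opX (ket x) = ket (x - 1) := by
  simp [opX, ket]

theorem opN_ket (x : Fin 3) : opN (ket x) = (-1 : ℂ) ^ (x : ℕ) • ket x := by
  ext y
  fin_cases x <;> fin_cases y <;> simp [opN, ket, pow_two]

/-- The purified `ℂ`-channel `[V, |0⟩, ℂ³]` for a unitary `V` on `ℂ³ = ℂ ⊗ ℂ³`. -/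
def qutritChannel (V : EuclideanSpace ℂ (Fin 3) ≃ₗᵢ[ℂ] EuclideanSpace ℂ (Fin 3)) :
    PurifiedChannel.{0, 0} ℂ where
  E := EuclideanSpace ℂ (Fin 3)
  ε := ket 0
  norm_ε := by simp [ket]
  U := V.lTensor ℂ

end

end PBS

/-! The three inclusions rest on different mechanisms. An isometry between the environments at the
hole, tensored with identities elsewhere, intertwines every word operator and preserves the initial
state; the partial trace does not see it. This gives `IsoLE.obsEquiv₂`. The step from `≈₂` to `≈₁`
only restricts the class of contexts. Without beam splitters the polarisation never influences the
route, so replacing every flip by a wire changes the semantics only by conjugation with a fixed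
polarisation operator (`diagramOp_eq_polOp_mul`); hence flip-free contexts already decide `≈₀`.

All separating examples are channels `I ⊗ A`, which touch only their environment. What a context can
learn about such a channel is governed by how often its hole is crossed. Because the path map is
injective, one gate occurrence is crossed at most twice along a path, and at most once without flips
(`Diagram.sum_count_word_le`). So two local channels whose orbits of `ε` agree for two steps are
`≈₂`-equivalent, and for one step `≈₁`-equivalent (`semantics_subst_localChannel`). A sign on `A` is
a global phase for `≈₀`, since both polarisations cross the same word of gates.

Conversely, loops containing a beam splitter let a vertical particle cross the gate while a
horizontal one avoids it. The coherence between the two is multiplied by `⟨ε, A ε⟩`, or by `⟨ε, A²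
ε⟩` when the loop also flips, so these numbers are invariants of `≈₁` and `≈₂`. The number `⟨x ⊗ ε,
U³ (x ⊗ ε)⟩` is an invariant of `≈_iso`. Finally, `X` and `XN` agree on `|0⟩ ↦ |2⟩ ↦ |1⟩` and differ
by a sign at the third step; `X` and the exchange of `|0⟩` and `|2⟩` agree for one step but not two;
the identity and its negative differ only by a sign. -/

namespace PBS

noncomputable section

/-! ### Partial traces and superoperators under changes of the environment. -/

section LinearAlgebra

section RankOne

variable {K E F G : Type*} [NormedAddCommGroup K] [InnerProductSpace ℂ K]
  [NormedAddCommGroup E] [InnerProductSpace ℂ E] [NormedAddCommGroup F] [InnerProductSpace ℂ F]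
  [NormedAddCommGroup G] [InnerProductSpace ℂ G]

@[simp]
theorem ketbra_apply (x : F) (y z : E) : ketbra x y z = (inner ℂ y z : ℂ) • x := rfl

theorem trace_ketbra [FiniteDimensional ℂ E] (x y : E) :
    LinearMap.trace ℂ E (ketbra x y) = inner ℂ y x :=
  InnerProductSpace.trace_rankOne x y

theorem ketbra_ne_zero {x : F} {y : E} (hx : x ≠ 0) (hy : y ≠ 0) : ketbra x y ≠ 0 := by
  intro h
  have := LinearMap.congr_fun h y
  simp [hx, hy] at this

theorem map_ketbra_ketbra (x : K) (y : E) (x' : F) (y' : G) :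
    TensorProduct.map (ketbra x y) (ketbra x' y') = ketbra (x ⊗ₜ[ℂ] x') (y ⊗ₜ[ℂ] y') := by
  apply TensorProduct.ext'
  intro a b
  simp [TensorProduct.smul_tmul', smul_smul, mul_comm]

/-- The map `k ↦ k ⊗ ε`. -/
def attach (K : Type*) [NormedAddCommGroup K] [InnerProductSpace ℂ K] (ε : E) :
    K →ₗ[ℂ] K ⊗[ℂ] E :=
  (TensorProduct.mk ℂ K E).flip ε

@[simp]
theorem attach_apply (ε : E) (k : K) : attach K ε k = k ⊗ₜ[ℂ] ε := rfl

end RankOne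

variable {K : Type*} [NormedAddCommGroup K] [InnerProductSpace ℂ K] [FiniteDimensional ℂ K]
variable {E : Type*} [NormedAddCommGroup E] [InnerProductSpace ℂ E] [FiniteDimensional ℂ E]
variable {F : Type*} [NormedAddCommGroup F] [InnerProductSpace ℂ F] [FiniteDimensional ℂ F]

theorem comp_ketbra_comp_adjoint (A : E →ₗ[ℂ] F) (x y : E) :
    A ∘ₗ ketbra x y ∘ₗ LinearMap.adjoint A = ketbra (A x) (A y) := by
  ext z
  simp [LinearMap.adjoint_inner_right]

/-- In finite dimension the operators `A ⊗ B` span, so identities about `partialTrace` and `gateOp`,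
both defined through `homTensorHomEquiv`, need only be checked there. The zero operator is itself of
the form `0 ⊗ 0`. -/
theorem end_tensor_induction {p : Module.End ℂ (K ⊗[ℂ] E) → Prop}
    (map : ∀ A B, p (TensorProduct.map A B)) (add : ∀ S T, p S → p T → p (S + T)) (T) : p T := by
  obtain ⟨t, rfl⟩ := (homTensorHomEquiv ℂ K E K E).surjective T
  have hm : ∀ A B, p (homTensorHomEquiv ℂ K E K E (A ⊗ₜ B)) := fun A B => by
    rw [homTensorHomEquiv_apply]
    exact map A B
  induction t with
  | zero => simpa using hm 0 0
  | tmul A B => exact hm A B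
  | add x y hx hy => rw [map_add]; exact add _ _ hx hy

/-- Cyclicity of the trace on the environment factor together with `W† W = 1`. -/
theorem partialTrace_isometry (W : E →ₗᵢ[ℂ] F) (T : Module.End ℂ (K ⊗[ℂ] E)) :
    partialTrace (W.toLinearMap.lTensor K ∘ₗ T ∘ₗ
      LinearMap.adjoint (W.toLinearMap.lTensor K)) = partialTrace T := by
  induction T using end_tensor_induction with
  | map A B =>
    have h : W.toLinearMap.lTensor K ∘ₗ TensorProduct.map A B ∘ₗ
        LinearMap.adjoint (W.toLinearMap.lTensor K) =
        TensorProduct.map A (W.toLinearMap ∘ₗ B ∘ₗ LinearMap.adjoint W.toLinearMap) := by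
      rw [LinearMap.adjoint_lTensor]
      ext x y
      rfl
    have hW : LinearMap.adjoint W.toLinearMap ∘ₗ W.toLinearMap = LinearMap.id := by
      ext x
      refine ext_inner_left ℂ fun y => ?_
      simp
    rw [h, partialTrace_map, partialTrace_map, LinearMap.trace_comp_comm', LinearMap.comp_assoc, hW,
      LinearMap.comp_id]
  | add S T hS hT => rw [LinearMap.add_comp, LinearMap.comp_add, map_add, hS, hT, map_add]

theorem partialTrace_conj (A B : Module.End ℂ K) (T : Module.End ℂ (K ⊗[ℂ] E)) :
    partialTrace (A.rTensor E * T * B.rTensor E) = A * partialTrace T * B := by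
  induction T using end_tensor_induction with
  | map C D =>
    have h : A.rTensor E * TensorProduct.map C D * B.rTensor E =
        TensorProduct.map (A * C * B) D := by
      ext x y
      rfl
    rw [h, partialTrace_map, partialTrace_map]
    simp
  | add S T hS hT => rw [mul_add, add_mul, map_add, hS, hT, map_add, mul_add, add_mul]

/-- This exhibits the superoperator as `ρ ↦ Tr_E (T ρ T†)` with `T k = U (k ⊗ ε)`, so only the
action of `U` on vectors `k ⊗ ε` matters. -/
theorem map_ketbra_self (ρ : Module.End ℂ K) (ε : E) :
    TensorProduct.map ρ (ketbra ε ε) = attach K ε ∘ₗ ρ ∘ₗ LinearMap.adjoint (attach K ε) := by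
  have h : ∀ (k : K) (e : E),
      LinearMap.adjoint (attach K ε) (k ⊗ₜ[ℂ] e) = (inner ℂ ε e : ℂ) • k := fun k e => by
    refine ext_inner_left ℂ fun v => ?_
    simp [LinearMap.adjoint_inner_right, inner_smul_right, mul_comm]
  apply TensorProduct.ext'
  intro k e
  simp [h, TensorProduct.smul_tmul']

theorem superoperator_apply (U : Module.End ℂ (K ⊗[ℂ] E)) (ε : E) (ρ : Module.End ℂ K) :
    superoperator U ε ρ = partialTrace
      ((U ∘ₗ attach K ε) ∘ₗ ρ ∘ₗ LinearMap.adjoint (U ∘ₗ attach K ε)) := by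
  rw [LinearMap.adjoint_comp]
  change partialTrace (U * TensorProduct.map ρ (ketbra ε ε) * LinearMap.adjoint U) = _
  rw [map_ketbra_self]
  rfl

/-- Two dilations related by an isometry of the environments define the same superoperator. -/
theorem superoperator_eq_of_isometry {U : Module.End ℂ (K ⊗[ℂ] E)} {ε : E}
    {U' : Module.End ℂ (K ⊗[ℂ] F)} {ε' : F} (W : E →ₗᵢ[ℂ] F)
    (h : ∀ k : K, U' (k ⊗ₜ[ℂ] ε') = W.toLinearMap.lTensor K (U (k ⊗ₜ[ℂ] ε))) :
    superoperator U ε = superoperator U' ε' := by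
  have h' : U' ∘ₗ attach K ε' = W.toLinearMap.lTensor K ∘ₗ (U ∘ₗ attach K ε) :=
    LinearMap.ext h
  ext1 ρ
  rw [superoperator_apply, superoperator_apply, h', ← partialTrace_isometry W]
  simp only [LinearMap.adjoint_comp, LinearMap.comp_assoc]

theorem superoperator_rTensor_mul (A : Module.End ℂ K) (U : Module.End ℂ (K ⊗[ℂ] E)) (ε : E)
    (ρ : Module.End ℂ K) :
    superoperator (A.rTensor E * U) ε ρ = A * superoperator U ε ρ * LinearMap.adjoint A := by
  change partialTrace _ = A * partialTrace _ * _
  rw [← partialTrace_conj, ← LinearMap.adjoint_rTensor]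
  congr 1
  change _ * _ * LinearMap.adjoint (_ ∘ₗ _) = _
  rw [LinearMap.adjoint_comp]
  simp only [mul_assoc]
  rfl

/-- The coherence between two branches is scaled by the overlap of the environment states they leave
behind; this is the source of all observable numbers below. -/
theorem superoperator_ketbra {U : Module.End ℂ (K ⊗[ℂ] E)} {ε : E} {k₁ k₂ l₁ l₂ : K} {e₁ e₂ : E}
    (h₁ : U (k₁ ⊗ₜ[ℂ] ε) = l₁ ⊗ₜ[ℂ] e₁) (h₂ : U (k₂ ⊗ₜ[ℂ] ε) = l₂ ⊗ₜ[ℂ] e₂) :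
    superoperator U ε (ketbra k₁ k₂) = (inner ℂ e₂ e₁ : ℂ) • ketbra l₁ l₂ := by
  rw [superoperator_apply, comp_ketbra_comp_adjoint]
  simp [h₁, h₂, ← map_ketbra_ketbra, partialTrace_map, trace_ketbra]

end LinearAlgebra

/-! ### Operators and isometries on the global environment. -/

section GlobalEnv

variable {ι : Type w} {E F : ι → Type v} [∀ i, NormedAddCommGroup (E i)]
  [∀ i, InnerProductSpace ℂ (E i)]
  [∀ i, NormedAddCommGroup (F i)] [∀ i, InnerProductSpace ℂ (F i)]

theorem GlobalEnv.tprod_induction {p : GlobalEnv E → Prop} (tprod : ∀ x, p (GlobalEnv.tprod x))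
    (add : ∀ x y, p x → p y → p (x + y)) (smul : ∀ (r : ℂ) x, p x → p (r • x)) (z) : p z := by
  induction z using PiTensorProduct.induction_on with
  | smul_tprod r x => exact smul r _ (tprod x)
  | add x y hx hy => exact add x y hx hy

open scoped Classical in
theorem GlobalEnv.tprod_update_add (x : ∀ i, E i) (a : ι) (y z : E a) :
    GlobalEnv.tprod (Function.update x a (y + z)) =
      GlobalEnv.tprod (Function.update x a y) + GlobalEnv.tprod (Function.update x a z) := by
  simp [GlobalEnv.tprod]

open scoped Classical in
theorem GlobalEnv.tprod_update_smul (x : ∀ i, E i) (a : ι) (r : ℂ) (y : E a) :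
    GlobalEnv.tprod (Function.update x a (r • y)) =
      r • GlobalEnv.tprod (Function.update x a y) := by
  simp [GlobalEnv.tprod]

variable (H : Type u) [NormedAddCommGroup H] [InnerProductSpace ℂ H]

open scoped Classical in
/-- The map `h ⊗ e ↦ h ⊗ ⨂ i, x' i`, where `x'` is `x` with `e` at the place `a`. -/
def insertEnv (x : ∀ i, E i) (a : ι) : H ⊗[ℂ] E a →ₗ[ℂ] H ⊗[ℂ] GlobalEnv E :=
  LinearMap.lTensor H
    { toFun := fun e => GlobalEnv.tprod (Function.update x a e)
      map_add' := GlobalEnv.tprod_update_add x a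
      map_smul' := GlobalEnv.tprod_update_smul x a }

open scoped Classical in
@[simp]
theorem insertEnv_tmul (x : ∀ i, E i) (a : ι) (h : H) (e : E a) :
    insertEnv H x a (h ⊗ₜ[ℂ] e) = h ⊗ₜ[ℂ] GlobalEnv.tprod (Function.update x a e) := rfl

theorem insertEnv_self (x : ∀ i, E i) (a : ι) (h : H) :
    insertEnv H x a (h ⊗ₜ[ℂ] x a) = h ⊗ₜ[ℂ] GlobalEnv.tprod x := by
  classical
  simp

variable {H}

/-- No scalar case is needed: scalars are absorbed by the factor in `H`. -/
theorem tmul_tprod_induction {p : H ⊗[ℂ] GlobalEnv E → Prop}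
    (tmul : ∀ h x, p (h ⊗ₜ[ℂ] GlobalEnv.tprod x))
    (add : ∀ x y, p x → p y → p (x + y)) (z) : p z := by
  induction z with
  | zero => simpa using tmul 0 0
  | tmul h e =>
    induction e using GlobalEnv.tprod_induction generalizing h with
    | tprod x => exact tmul h x
    | add x y hx hy => rw [TensorProduct.tmul_add]; exact add _ _ (hx h) (hy h)
    | smul r x hx => rw [← TensorProduct.smul_tmul]; exact hx _
  | add x y hx hy => exact add x y hx hy

variable [∀ i, FiniteDimensional ℂ (E i)] [∀ i, FiniteDimensional ℂ (F i)]

/-- The tensor product of a family of isometries. -/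
def GlobalEnv.mapIsometry [Finite ι] (W : ∀ i, E i →ₗᵢ[ℂ] F i) : GlobalEnv E →ₗᵢ[ℂ] GlobalEnv F :=
  (show GlobalEnv E →ₗ[ℂ] GlobalEnv F from
    PiTensorProduct.map fun i => (W i).toLinearMap).isometryOfInner (by
      have : Fintype ι := Fintype.ofFinite ι
      have hW : ∀ x : ∀ i, E i, (show GlobalEnv E →ₗ[ℂ] GlobalEnv F from
          PiTensorProduct.map fun i => (W i).toLinearMap) (GlobalEnv.tprod x) =
          GlobalEnv.tprod fun i => W i (x i) := fun x => PiTensorProduct.map_tprod _ _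
      -- Both sides are sesquilinear, so product vectors suffice; there the inner product factors
      -- over the index set.
      intro x y
      induction x using GlobalEnv.tprod_induction with
      | tprod x =>
        induction y using GlobalEnv.tprod_induction with
        | tprod y => simp [hW, GlobalEnv.inner_tprod]
        | add y z hy hz => rw [map_add, inner_add_right, inner_add_right, hy, hz]
        | smul r y hy => rw [map_smul, inner_smul_right, inner_smul_right, hy]
      | add y z hy hz => rw [map_add, inner_add_left, inner_add_left, hy, hz]
      | smul r y hy => rw [map_smul, inner_smul_left, inner_smul_left, hy])

theorem GlobalEnv.mapIsometry_tprod [Finite ι] (W : ∀ i, E i →ₗᵢ[ℂ] F i) (x : ∀ i, E i) :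
    GlobalEnv.mapIsometry W (GlobalEnv.tprod x) = GlobalEnv.tprod fun i => W i (x i) :=
  PiTensorProduct.map_tprod _ _

variable [FiniteDimensional ℂ H]

/-- With the other factors frozen, a gate operator is just `U` on `H ⊗ E a`. This remains usable
when `U` entangles the two, where no formula on product vectors is available. -/
theorem gateOp_insertEnv (x : ∀ i, E i) (a : ι) (U : Module.End ℂ (H ⊗[ℂ] E a))
    (ξ : H ⊗[ℂ] E a) : gateOp E H a U (insertEnv H x a ξ) = insertEnv H x a (U ξ) := by
  classical
  induction U using end_tensor_induction with
  | map A B =>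
    induction ξ with
    | zero => simp
    | tmul h e => simp [gateOp_map_tprod]
    | add ξ η hξ hη => rw [map_add, map_add, hξ, hη, map_add, map_add]
  | add S T hS hT =>
    rw [map_add, LinearMap.add_apply, hS, hT, LinearMap.add_apply, map_add]

theorem gateOp_tmul_tprod (x : ∀ i, E i) (a : ι) (U : Module.End ℂ (H ⊗[ℂ] E a)) (h : H) :
    gateOp E H a U (h ⊗ₜ[ℂ] GlobalEnv.tprod x) = insertEnv H x a (U (h ⊗ₜ[ℂ] x a)) := by
  rw [← gateOp_insertEnv, insertEnv_self]

theorem gateOp_mapIsometry [Finite ι] (W : ∀ i, E i →ₗᵢ[ℂ] F i) (a : ι)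
    {U : Module.End ℂ (H ⊗[ℂ] E a)} {U' : Module.End ℂ (H ⊗[ℂ] F a)}
    (hU : ∀ ξ, (W a).toLinearMap.lTensor H (U ξ) = U' ((W a).toLinearMap.lTensor H ξ))
    (ξ : H ⊗[ℂ] GlobalEnv E) :
    gateOp F H a U' ((GlobalEnv.mapIsometry W).toLinearMap.lTensor H ξ) =
      (GlobalEnv.mapIsometry W).toLinearMap.lTensor H (gateOp E H a U ξ) := by
  classical
  -- Reduction to the single factor `a`, where the hypothesis `hU` applies.
  have hW : ∀ (x : ∀ i, E i) (η : H ⊗[ℂ] E a),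
      (GlobalEnv.mapIsometry W).toLinearMap.lTensor H (insertEnv H x a η) =
        insertEnv H (fun i => W i (x i)) a ((W a).toLinearMap.lTensor H η) := fun x η => by
    induction η with
    | zero => simp
    | tmul h e =>
      simp only [insertEnv_tmul, LinearMap.lTensor_tmul, LinearIsometry.coe_toLinearMap,
        GlobalEnv.mapIsometry_tprod]
      congr 2
      funext i
      by_cases hi : i = a
      · subst hi; simp
      · simp [hi]
    | add η ζ hη hζ => simp only [map_add, hη, hζ]
  induction ξ using tmul_tprod_induction with
  | tmul h x => rw [← insertEnv_self H x a h, hW, gateOp_insertEnv, gateOp_insertEnv, hW, hU]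
  | add ξ η hξ hη => simp only [map_add, hξ, hη]

end GlobalEnv

/-! ### The semantics evaluated on basis states of the particle. -/

section Semantics

variable {H : Type u} [NormedAddCommGroup H] [InnerProductSpace ℂ H]

/-- The embedding `ξ ↦ |c⟩ ⊗ |p⟩ ⊗ ξ`. -/
def atState {n : ℕ} (s : Pol × Fin n) (X : Type*) [AddCommGroup X] [Module ℂ X] :
    H ⊗[ℂ] X →ₗ[ℂ] Particle H n ⊗[ℂ] X :=
  ((TensorProduct.assoc ℂ _ _ _).trans
      (TensorProduct.congr (LinearEquiv.refl ℂ _) (TensorProduct.assoc ℂ _ _ _))).symm.toLinearMap ∘ₗ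
    TensorProduct.mk ℂ _ _ (EuclideanSpace.single s.1 (1 : ℂ)) ∘ₗ
      TensorProduct.mk ℂ _ _ (EuclideanSpace.single s.2 (1 : ℂ))

/-- The state `|c⟩ ⊗ |p⟩ ⊗ h` of the particle. -/
def particleState {n : ℕ} (s : Pol × Fin n) (h : H) : Particle H n :=
  EuclideanSpace.single s.1 (1 : ℂ) ⊗ₜ[ℂ] (EuclideanSpace.single s.2 (1 : ℂ) ⊗ₜ[ℂ] h)

@[simp]
theorem atState_tmul {n : ℕ} (s : Pol × Fin n) {X : Type*} [AddCommGroup X] [Module ℂ X]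
    (h : H) (x : X) : atState s X (h ⊗ₜ[ℂ] x) = particleState s h ⊗ₜ[ℂ] x := by
  simp [atState, particleState]

theorem lTensor_atState {n : ℕ} (s : Pol × Fin n) {X Y : Type*} [AddCommGroup X] [Module ℂ X]
    [AddCommGroup Y] [Module ℂ Y] (T : X →ₗ[ℂ] Y) (ξ : H ⊗[ℂ] X) :
    T.lTensor (Particle H n) (atState s X ξ) = atState s Y (T.lTensor H ξ) := by
  induction ξ with
  | zero => simp
  | tmul h e => simp
  | add ξ η hξ hη => simp only [map_add, hξ, hη]

theorem particleState_ne_zero {n : ℕ} (s : Pol × Fin n) {h : H} (hh : h ≠ 0) :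
    particleState s h ≠ 0 := by
  have hn : ‖particleState s h‖ = ‖h‖ := by simp [particleState]
  exact fun h0 => hh (norm_eq_zero.mp (hn.symm.trans ((congrArg _ h0).trans (norm_zero (E := Particle H n)))))

theorem particleState_induction {n : ℕ} {p : Particle H n → Prop}
    (state : ∀ s h, p (particleState s h)) (zero : p 0) (add : ∀ x y, p x → p y → p (x + y)) (z) :
    p z := by
  have hE : ∀ {ι : Type} [Fintype ι] [DecidableEq ι] (x : EuclideanSpace ℂ ι),
      x = ∑ i, x i • EuclideanSpace.single i (1 : ℂ) := fun x => by
    ext j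
    rw [WithLp.ofLp_sum, Finset.sum_apply]
    simp
  have hsum : ∀ {ι : Type} (s : Finset ι) (f : ι → Particle H n), (∀ i, p (f i)) →
      p (∑ i ∈ s, f i) := fun s f hf => Finset.sum_induction f p add zero fun i _ => hf i
  induction z using TensorProduct.induction_on with
  | zero => exact zero
  | tmul x y =>
    rw [hE x, TensorProduct.sum_tmul]
    refine hsum _ _ fun c => ?_
    induction y with
    | zero => simpa using zero
    | tmul y h =>
      rw [hE y, TensorProduct.sum_tmul, TensorProduct.tmul_sum]
      refine hsum _ _ fun i => ?_
      -- The coordinates of both vectors are moved into the `H` factor.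
      have := state (c, i) (y i • x c • h)
      simpa only [particleState, TensorProduct.tmul_smul, ← TensorProduct.smul_tmul'] using this
    | add y z hy hz => rw [TensorProduct.tmul_add]; exact add _ _ hy hz
  | add x y hx hy => exact add x y hx hy

variable [FiniteDimensional ℂ H] {ι : Type w}

/-- By orthonormality of the basis states only the summand indexed by `s` survives. -/
theorem diagramOp_atState {n : ℕ} (D : Diagram ι n) (G : ι → PurifiedChannel.{u, v} H)
    (s : Pol × Fin n) (ξ : H ⊗[ℂ] Env G) :
    diagramOp D G (atState s _ ξ) = atState (D.target s) _ (wordOp G (D.word s) ξ) := by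
  simp only [diagramOp, atState, LinearEquiv.conj_apply, LinearMap.comp_apply,
    LinearEquiv.coe_coe, LinearEquiv.symm_symm, LinearEquiv.apply_symm_apply,
    LinearMap.sum_apply, TensorProduct.mk_apply, TensorProduct.map_tmul, ketbra_apply]
  rw [Finset.sum_eq_single s]
  · simp
  · intro t _ hts
    have : t.1 ≠ s.1 ∨ t.2 ≠ s.2 := by
      by_contra! h
      exact hts (Prod.ext h.1 h.2)
    have h0 : ∀ {κ : Type} [Fintype κ] [DecidableEq κ] {i j : κ}, i ≠ j →
        inner ℂ (EuclideanSpace.single i (1 : ℂ)) (EuclideanSpace.single j (1 : ℂ)) = (0 : ℂ) :=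
      fun hij => by rw [EuclideanSpace.inner_single_left]; simp [hij]
    rcases this with h | h
    · rw [h0 h, zero_smul, TensorProduct.zero_tmul]
    · rw [h0 h, zero_smul, TensorProduct.zero_tmul, TensorProduct.tmul_zero]
  · simp

theorem diagramOp_particleState {n : ℕ} (D : Diagram ι n) (G : ι → PurifiedChannel.{u, v} H)
    (s : Pol × Fin n) (h : H) (x : Env G) :
    diagramOp D G (particleState s h ⊗ₜ[ℂ] x) =
      atState (D.target s) _ (wordOp G (D.word s) (h ⊗ₜ[ℂ] x)) := by
  rw [← diagramOp_atState, atState_tmul]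

/-- The superoperator of a diagram whose gates are interpreted by a family of purified
channels. -/
def interp [Finite ι] {n : ℕ} (D : Diagram ι n) (G : ι → PurifiedChannel.{u, v} H) :
    Module.End ℂ (Particle H n) →ₗ[ℂ] Module.End ℂ (Particle H n) :=
  superoperator (K := Particle H n) (E := Env G) (diagramOp D G) (envState G)

/-- Targets depend on `D` alone, so comparing two gate families reduces to comparing word operators
on the initial environment state. One isometry must serve all entry states `s`, since coherences
between them are observed too. -/
theorem interp_eq_of_isometry [Finite ι] {n : ℕ} (D : Diagram ι n)
    {G G' : ι → PurifiedChannel.{u, v} H} (W : Env G →ₗᵢ[ℂ] Env G')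
    (h : ∀ s x, wordOp G' (D.word s) (x ⊗ₜ[ℂ] envState G') =
      W.toLinearMap.lTensor H (wordOp G (D.word s) (x ⊗ₜ[ℂ] envState G))) :
    interp D G = interp D G' := by
  refine superoperator_eq_of_isometry W fun k => ?_
  induction k using particleState_induction with
  | state s x => rw [diagramOp_particleState, diagramOp_particleState, lTensor_atState, h]
  | zero => simp
  | add x y hx hy => simp only [TensorProduct.add_tmul, map_add, hx, hy]

theorem interp_eq_of_isoLE [Finite ι] {n : ℕ} (D : Diagram ι n)
    {G G' : ι → PurifiedChannel.{u, v} H} (h : ∀ i, IsoLE (G i) (G' i)) :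
    interp D G = interp D G' := by
  choose W hε hU using h
  refine interp_eq_of_isometry D (GlobalEnv.mapIsometry W) fun s x => ?_
  have hw : ∀ (w : List ι) (ξ : H ⊗[ℂ] Env G),
      wordOp G' w ((GlobalEnv.mapIsometry W).toLinearMap.lTensor H ξ) =
        (GlobalEnv.mapIsometry W).toLinearMap.lTensor H (wordOp G w ξ) := by
    intro w
    induction w with
    | nil => exact fun ξ => rfl
    | cons a w ih =>
      intro ξ
      simp only [wordOp, Module.End.mul_apply]
      rw [← ih]
      congr 1
      exact gateOp_mapIsometry W a (hU a) ξ
  rw [← hw]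
  simp [envState, GlobalEnv.mapIsometry_tprod, hε]

end Semantics

/-! ### Basic properties of paths. -/

namespace Diagram

variable {Λ : Type w} {n : ℕ}

theorem path_word (D : Diagram Λ n) (s : Pol × Fin n) : Path D s (D.word s) (D.target s) :=
  (path_iff D s _ _).2 ⟨rfl, rfl⟩

theorem Path.word_eq {D : Diagram Λ n} {s t : Pol × Fin n} {x : List Λ} (h : Path D s x t) :
    D.word s = x :=
  ((path_iff D s x t).1 h).1.symm

theorem Path.target_eq {D : Diagram Λ n} {s t : Pol × Fin n} {x : List Λ} (h : Path D s x t) :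
    D.target s = t :=
  ((path_iff D s x t).1 h).2.symm

theorem target_injective (D : Diagram Λ n) : Function.Injective D.target := fun s t h =>
  (Path.main D).2.1 _ _ _ _ _ (path_word D s) (h ▸ path_word D t)

theorem path_map {Λ' : Type v} (f : Λ → Λ') {D : Diagram Λ n} {s t : Pol × Fin n} {x : List Λ}
    (h : Path D s x t) : Path (D.map f) s (x.map f) t := by
  induction D generalizing x with
  | empty => exact h
  | wire | neg | swap | pbs => obtain ⟨rfl, rfl⟩ := h; exact ⟨rfl, rfl⟩
  | gate a => obtain ⟨rfl, rfl⟩ := h; exact ⟨rfl, rfl⟩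
  | comp D₂ D₁ ih₂ ih₁ =>
    obtain ⟨y, r, z, h₁, h₂, rfl⟩ := h
    exact ⟨_, _, _, ih₁ h₁, ih₂ h₂, List.map_append⟩
  | par D₁ D₂ ih₁ ih₂ =>
    rcases h with ⟨p, p', hp, hp', h⟩ | ⟨p, p', hp, hp', h⟩
    · exact Or.inl ⟨p, p', hp, hp', ih₁ h⟩
    · exact Or.inr ⟨p, p', hp, hp', ih₂ h⟩
  | tr D ih =>
    rcases h with h | ⟨_, _, _, h₀, h₁, rfl⟩ | ⟨_, _, _, _, _, h₀, h₁, h₂, rfl⟩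
    · exact Or.inl (ih h)
    · exact Or.inr (Or.inl ⟨_, _, _, ih h₀, ih h₁, by simp⟩)
    · exact Or.inr (Or.inr ⟨_, _, _, _, _, ih h₀, ih h₁, ih h₂, by simp⟩)

theorem word_map {Λ' : Type v} (f : Λ → Λ') (D : Diagram Λ n) (s : Pol × Fin n) :
    (D.map f).word s = (D.word s).map f :=
  (path_map f (path_word D s)).word_eq

theorem Path.fst_eq {D : Diagram Λ n} (hD : D.NegFree) {s t : Pol × Fin n} {x : List Λ}
    (h : Path D s x t) : t.1 = s.1 := by
  induction D generalizing x with
  | empty => exact h.elim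
  | wire | swap => obtain ⟨-, rfl⟩ := h; rfl
  | pbs => obtain ⟨-, rfl⟩ := h; obtain ⟨_ | _, p⟩ := s <;> rfl
  | neg => exact hD.elim
  | gate a => obtain ⟨-, rfl⟩ := h; rfl
  | comp D₂ D₁ ih₂ ih₁ =>
    obtain ⟨y, r, z, h₁, h₂, rfl⟩ := h
    exact (ih₂ hD.1 h₂).trans (ih₁ hD.2 h₁)
  | par D₁ D₂ ih₁ ih₂ =>
    rcases h with ⟨p, p', hp, hp', h⟩ | ⟨p, p', hp, hp', h⟩
    · exact ih₁ hD.1 h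
    · exact ih₂ hD.2 h
  | tr D ih =>
    rcases h with h | ⟨_, _, _, h₀, h₁, rfl⟩ | ⟨_, _, _, _, _, h₀, h₁, h₂, rfl⟩
    · exact ih hD h
    · exact (ih hD h₁).trans (ih hD h₀)
    · exact (ih hD h₂).trans ((ih hD h₁).trans (ih hD h₀))

/-! ### How often a gate is crossed -/

/-- The number of occurrences of a gate in a diagram. -/
def mult [DecidableEq Λ] (a : Λ) : {n : ℕ} → Diagram Λ n → ℕ
  | _, .gate b => if b = a then 1 else 0
  | _, .comp D₂ D₁ => mult a D₂ + mult a D₁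
  | _, .par D₁ D₂ => mult a D₁ + mult a D₂
  | _, .tr D => mult a D
  | _, _ => 0

theorem mult_map_eq_zero {Λ' : Type v} [DecidableEq Λ'] (f : Λ → Λ') {a : Λ'} (ha : ∀ b, f b ≠ a)
    (D : Diagram Λ n) : (D.map f).mult a = 0 := by
  induction D <;> simp_all [map, mult]

/-- A path of the traced diagram concatenates paths of `D`, and by injectivity of `D.target` each
state on the fed-back wire is used by at most one entering particle. Thus every word of `D` is
charged at most once. Invariance of `B` keeps the polarisations met on that wire inside `B`. -/
theorem sum_count_word_tr_le [DecidableEq Λ] (D : Diagram Λ (n + 1)) (a : Λ) (B : Finset Pol)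
    (hB : ∀ s, s.1 ∈ B → (D.target s).1 ∈ B) :
    ∑ c ∈ B, ∑ p, ((tr D).word (c, p)).count a ≤ ∑ c ∈ B, ∑ p, (D.word (c, p)).count a := by
  classical
  let f : Pol × Fin (n + 1) → ℕ := fun s => (D.word s).count a
  -- The particle entering at `s` arrives on the traced wire with polarisation `d`, directly or
  -- after one earlier pass.
  let visit : Pol × Fin n → Pol → Prop := fun s d =>
    D.target (s.1, s.2.castSucc) = (d, Fin.last n) ∨
      ∃ e, D.target (s.1, s.2.castSucc) = (e, Fin.last n) ∧
        D.target (e, Fin.last n) = (d, Fin.last n)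
  have hne : ∀ (s : Pol × Fin n) (c : Pol), (s.1, s.2.castSucc) ≠ (c, Fin.last n) := fun s c h =>
    Fin.castSucc_ne_last _ (congrArg Prod.snd h)
  have hvisit : ∀ s s' d, visit s d → visit s' d → s = s' := by
    have key : ∀ s s' : Pol × Fin n,
        D.target (s.1, s.2.castSucc) = D.target (s'.1, s'.2.castSucc) → s = s' := fun s s' h => by
      have := D.target_injective h
      simpa [Prod.ext_iff] using this
    rintro s s' d (h | ⟨e, h, k⟩) (h' | ⟨e', h', k'⟩)
    · exact key _ _ (h.trans h'.symm)
    · exact (hne _ _ (D.target_injective (h.trans k'.symm))).elim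
    · exact (hne _ _ (D.target_injective (h'.trans k.symm))).elim
    · have := D.target_injective (k.trans k'.symm)
      exact key _ _ (h.trans (this ▸ h'.symm))
  have hword : ∀ s : Pol × Fin n, s.1 ∈ B → ((tr D).word s).count a ≤
      f (s.1, s.2.castSucc) + ∑ d ∈ B, if visit s d then f (d, Fin.last n) else 0 := by
    intro s hs
    have hsB := hB (s.1, s.2.castSucc) hs
    rcases path_word (tr D) s with h | ⟨w₀, c₁, w₁, h₀, h₁, hw⟩ |
      ⟨w₀, c₁, w₁, c₂, w₂, h₀, h₁, h₂, hw⟩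
    · rw [← h.word_eq]
      exact Nat.le_add_right _ _
    · rw [h₀.target_eq] at hsB
      rw [hw, ← h₀.word_eq, ← h₁.word_eq, List.count_append]
      refine Nat.add_le_add_left ?_ _
      refine le_trans ?_ (Finset.single_le_sum (fun _ _ => Nat.zero_le _) hsB)
      rw [if_pos (Or.inl h₀.target_eq)]
    · rw [h₀.target_eq] at hsB
      have hsB₂ := hB (c₁, Fin.last n) hsB
      rw [h₁.target_eq] at hsB₂
      -- Otherwise the fed-back state would be a fixed point of `D.target`, having the entry state
      -- as a second preimage.
      have hc : c₁ ≠ c₂ := by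
        rintro rfl
        exact hne s c₁ (D.target_injective (h₀.target_eq.trans h₁.target_eq.symm))
      rw [hw, ← h₀.word_eq, ← h₁.word_eq, ← h₂.word_eq, List.count_append, List.count_append,
        add_assoc]
      refine Nat.add_le_add_left ?_ _
      refine le_trans ?_ (Finset.sum_le_sum_of_subset
        (show {c₁, c₂} ⊆ B by simp [Finset.insert_subset_iff, hsB, hsB₂]))
      rw [Finset.sum_pair hc, if_pos (Or.inl h₀.target_eq),
        if_pos (Or.inr ⟨_, h₀.target_eq, h₁.target_eq⟩)]
  have hlast : ∀ d, (∑ c ∈ B, ∑ p, if visit (c, p) d then f (d, Fin.last n) else 0) ≤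
      f (d, Fin.last n) := by
    intro d
    rw [← Finset.sum_product' B Finset.univ
      (fun c p => if visit (c, p) d then f (d, Fin.last n) else 0), ← Finset.sum_filter,
      Finset.sum_const, smul_eq_mul]
    refine (Nat.mul_le_mul_right _ (Finset.card_le_one.2 ?_)).trans (one_mul _).le
    intro s hs s' hs'
    exact hvisit s s' d (Finset.mem_filter.1 hs).2 (Finset.mem_filter.1 hs').2
  calc ∑ c ∈ B, ∑ p, ((tr D).word (c, p)).count a
      ≤ ∑ c ∈ B, ∑ p : Fin n, (f (c, p.castSucc) +
          ∑ d ∈ B, if visit (c, p) d then f (d, Fin.last n) else 0) :=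
        Finset.sum_le_sum fun c hc => Finset.sum_le_sum fun p _ => hword (c, p) hc
    _ = ∑ c ∈ B, ∑ p : Fin n, f (c, p.castSucc) +
          ∑ d ∈ B, ∑ c ∈ B, ∑ p, if visit (c, p) d then f (d, Fin.last n) else 0 := by
        simp only [Finset.sum_add_distrib]
        exact congrArg _
          (Finset.sum_comm.trans (Finset.sum_congr rfl fun c _ => Finset.sum_comm)).symm
    _ ≤ ∑ c ∈ B, ∑ p : Fin n, f (c, p.castSucc) + ∑ d ∈ B, f (d, Fin.last n) :=
        Nat.add_le_add_left (Finset.sum_le_sum fun d _ => hlast d) _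
    _ = ∑ c ∈ B, ∑ p, (D.word (c, p)).count a := by
        simp only [Fin.sum_univ_castSucc, Finset.sum_add_distrib, f]

/-- Bounding the total over all entry states makes the induction work: each occurrence of the gate
contributes once per polarisation in `B`. The polarisations met must stay in `B`, which is automatic
for all of them, and for any `B` when there are no flips. -/
theorem sum_count_word_le [DecidableEq Λ] (D : Diagram Λ n) (a : Λ) (B : Finset Pol)
    (hB : D.NegFree ∨ B = Finset.univ) :
    ∑ c ∈ B, ∑ p, (D.word (c, p)).count a ≤ B.card * D.mult a := by
  have hmem : ∀ {m : ℕ} (D : Diagram Λ m), D.NegFree ∨ B = Finset.univ →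
      ∀ s, s.1 ∈ B → (D.target s).1 ∈ B := by
    rintro m D (hD | rfl) s hs
    · rwa [(path_word D s).fst_eq hD]
    · exact Finset.mem_univ _
  have hnil : ∀ {m : ℕ} (D : Diagram Λ m), (∀ s, D.word s = []) →
      ∑ c ∈ B, ∑ p, (D.word (c, p)).count a ≤ B.card * D.mult a := fun D h => by simp [h]
  induction D with
  | empty => simp
  | wire => exact hnil _ fun s => Path.word_eq (D := wire) ⟨rfl, rfl⟩
  | neg => exact hnil _ fun s => Path.word_eq (D := neg) ⟨rfl, rfl⟩
  | swap => exact hnil _ fun s => Path.word_eq (D := swap) ⟨rfl, rfl⟩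
  | pbs => exact hnil _ fun s => Path.word_eq (D := pbs) ⟨rfl, rfl⟩
  | gate b =>
    have h : ∀ s, (gate b).word s = [b] := fun s => Path.word_eq (D := gate b) ⟨rfl, rfl⟩
    simp [h, mult, List.count_singleton]
  | @comp n D₂ D₁ ih₂ ih₁ =>
    have hw : ∀ s, (comp D₂ D₁).word s = D₁.word s ++ D₂.word (D₁.target s) := fun s =>
      Path.word_eq (D := comp D₂ D₁) ⟨_, _, _, path_word D₁ s, path_word D₂ _, rfl⟩
    have h₁ := hB.imp_left And.right
    have h₂ := hB.imp_left And.left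
    -- `D₁.target` is injective and maps `B × Fin n` into itself, so distinct particles enter `D₂`
    -- in distinct states.
    have key : ∑ c ∈ B, ∑ p, (D₂.word (D₁.target (c, p))).count a ≤
        ∑ c ∈ B, ∑ p, (D₂.word (c, p)).count a := by
      simp only [← Finset.sum_product']
      rw [← Finset.sum_image (s := B ×ˢ Finset.univ) (g := D₁.target)
        (f := fun s => (D₂.word s).count a) fun x _ y _ h => D₁.target_injective h]
      refine Finset.sum_le_sum_of_subset fun s hs => ?_
      obtain ⟨r, hr, rfl⟩ := Finset.mem_image.1 hs
      simpa using hmem D₁ h₁ r (by simpa using hr)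
    simp only [hw, List.count_append, Finset.sum_add_distrib, mult, mul_add]
    have := ih₁ h₁
    have := ih₂ h₂
    omega
  | @par n m D₁ D₂ ih₁ ih₂ =>
    have hl : ∀ c p, (par D₁ D₂).word (c, p.castAdd m) = D₁.word (c, p) := fun c p =>
      Path.word_eq (t := ((D₁.target (c, p)).1, (D₁.target (c, p)).2.castAdd m))
        (Or.inl ⟨p, _, rfl, rfl, path_word D₁ (c, p)⟩)
    have hr : ∀ c p, (par D₁ D₂).word (c, p.natAdd n) = D₂.word (c, p) := fun c p =>
      Path.word_eq (t := ((D₂.target (c, p)).1, (D₂.target (c, p)).2.natAdd n))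
        (Or.inr ⟨p, _, rfl, rfl, path_word D₂ (c, p)⟩)
    simp only [Fin.sum_univ_add, hl, hr, Finset.sum_add_distrib, mult, mul_add]
    exact Nat.add_le_add (ih₁ (hB.imp_left And.left)) (ih₂ (hB.imp_left And.right))
  | tr D ih => exact (sum_count_word_tr_le D a B (hmem D hB)).trans (ih hB)

theorem count_word_le [DecidableEq Λ] (D : Diagram Λ n) (a : Λ) (s : Pol × Fin n) :
    (D.word s).count a ≤ 2 * D.mult a := by
  refine le_trans ?_ (D.sum_count_word_le a Finset.univ (Or.inr rfl))
  refine le_trans ?_ (Finset.single_le_sum (fun _ _ => Nat.zero_le _) (Finset.mem_univ s.1))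
  exact Finset.single_le_sum (f := fun p => (D.word (s.1, p)).count a)
    (fun _ _ => Nat.zero_le _) (Finset.mem_univ s.2)

theorem NegFree.count_word_le [DecidableEq Λ] {D : Diagram Λ n} (hD : D.NegFree) (a : Λ)
    (s : Pol × Fin n) : (D.word s).count a ≤ D.mult a := by
  -- Without flips a single polarisation is already invariant, which saves the factor two.
  have h := D.sum_count_word_le a {s.1} (Or.inl hD)
  rw [Finset.sum_singleton, Finset.card_singleton, one_mul] at h
  exact (Finset.single_le_sum (f := fun p => (D.word (s.1, p)).count a)
    (fun _ _ => Nat.zero_le _) (Finset.mem_univ s.2)).trans h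

/-! ### Removing the polarisation flips -/

/-- The diagram with wires in place of its polarisation flips. -/
def deneg : {n : ℕ} → Diagram Λ n → Diagram Λ n
  | _, .neg => .wire
  | _, .comp D₂ D₁ => .comp (deneg D₂) (deneg D₁)
  | _, .par D₁ D₂ => .par (deneg D₁) (deneg D₂)
  | _, .tr D => .tr (deneg D)
  | _, .gate a => .gate a
  | _, .empty => .empty
  | _, .wire => .wire
  | _, .swap => .swap
  | _, .pbs => .pbs

theorem negFree_deneg (D : Diagram Λ n) : D.deneg.NegFree := by
  induction D with
  | comp D₂ D₁ ih₂ ih₁ => exact ⟨ih₂, ih₁⟩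
  | par D₁ D₂ ih₁ ih₂ => exact ⟨ih₁, ih₂⟩
  | tr D ih => exact ih
  | _ => trivial

theorem deneg_map {Λ' : Type v} (f : Λ → Λ') (D : Diagram Λ n) :
    (D.map f).deneg = D.deneg.map f := by
  induction D <;> simp_all [map, deneg]

theorem pbsFree_map {Λ' : Type v} (f : Λ → Λ') (D : Diagram Λ n) :
    (D.map f).PBSFree ↔ D.PBSFree := by
  induction D <;> simp_all [map, PBSFree]

theorem negFree_map {Λ' : Type v} (f : Λ → Λ') (D : Diagram Λ n) :
    (D.map f).NegFree ↔ D.NegFree := by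
  induction D <;> simp_all [map, NegFree]

/-- Only beam splitters read the polarisation; without them the route depends on the position alone,
and `c` may be chosen freely. -/
theorem path_deneg {D : Diagram Λ n} (hD : D.PBSFree) {s t : Pol × Fin n} {x : List Λ}
    (h : Path D s x t) (c : Pol) : Path D.deneg (c, s.2) x (c, t.2) := by
  induction D generalizing x with
  | empty => exact h.elim
  | wire | neg | swap => obtain ⟨rfl, rfl⟩ := h; exact ⟨rfl, rfl⟩
  | pbs => exact hD.elim
  | gate a => obtain ⟨rfl, rfl⟩ := h; exact ⟨rfl, rfl⟩
  | comp D₂ D₁ ih₂ ih₁ =>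
    obtain ⟨y, r, z, h₁, h₂, rfl⟩ := h
    exact ⟨_, _, _, ih₁ hD.2 h₁, ih₂ hD.1 h₂, rfl⟩
  | par D₁ D₂ ih₁ ih₂ =>
    rcases h with ⟨p, p', hp, hp', h⟩ | ⟨p, p', hp, hp', h⟩
    · exact Or.inl ⟨p, p', hp, hp', ih₁ hD.1 h⟩
    · exact Or.inr ⟨p, p', hp, hp', ih₂ hD.2 h⟩
  | tr D ih =>
    rcases h with h | ⟨_, _, _, h₀, h₁, rfl⟩ | ⟨_, _, _, _, _, h₀, h₁, h₂, rfl⟩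
    · exact Or.inl (ih hD h)
    · exact Or.inr (Or.inl ⟨_, _, _, ih hD h₀, ih hD h₁, rfl⟩)
    · exact Or.inr (Or.inr ⟨_, _, _, _, _, ih hD h₀, ih hD h₁, ih hD h₂, rfl⟩)

theorem PBSFree.word_eq_word_deneg {D : Diagram Λ n} (hD : D.PBSFree) (c d : Pol) (p : Fin n) :
    D.word (c, p) = D.deneg.word (d, p) :=
  (path_deneg hD (path_word D (c, p)) d).word_eq.symm

theorem PBSFree.target_deneg {D : Diagram Λ n} (hD : D.PBSFree) (c d : Pol) (p : Fin n) :
    D.deneg.target (d, p) = (d, (D.target (c, p)).2) :=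
  (path_deneg hD (path_word D (c, p)) d).target_eq

end Diagram

/-! ### Gate occurrences of a relabelled diagram -/

/-- A diagram with distinct gates together with a labelling of the gates. -/
structure LabelledDiagram (Λ : Type w) (n : ℕ) : Type (max 1 w) where
  Pos : Type
  finite : Finite Pos
  shape : Diagram Pos n
  label : Pos → Λ

namespace Diagram

variable {Λ : Type w} {n : ℕ}

/-- The bare diagram of a diagram, with its labels. -/
def toLabelled (D : Diagram Λ n) : LabelledDiagram Λ n :=
  ⟨D.Pos, D.finite_pos, D.bare, D.label⟩

/-- Sequential composition of labelled diagrams. -/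
def _root_.PBS.LabelledDiagram.comp (L₂ L₁ : LabelledDiagram Λ n) : LabelledDiagram Λ n :=
  have := L₁.finite
  have := L₂.finite
  ⟨L₂.Pos ⊕ L₁.Pos, inferInstance, .comp (L₂.shape.map Sum.inl) (L₁.shape.map Sum.inr),
    Sum.elim L₂.label L₁.label⟩

/-- Parallel composition of labelled diagrams. -/
def _root_.PBS.LabelledDiagram.par {m : ℕ} (L₁ : LabelledDiagram Λ n) (L₂ : LabelledDiagram Λ m) :
    LabelledDiagram Λ (n + m) :=
  have := L₁.finite
  have := L₂.finite
  ⟨L₁.Pos ⊕ L₂.Pos, inferInstance, .par (L₁.shape.map Sum.inl) (L₂.shape.map Sum.inr),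
    Sum.elim L₁.label L₂.label⟩

/-- Trace of a labelled diagram. -/
def _root_.PBS.LabelledDiagram.tr (L : LabelledDiagram Λ (n + 1)) : LabelledDiagram Λ n :=
  ⟨L.Pos, L.finite, .tr L.shape, L.label⟩

/-- The type of occurrences varies with the diagram. Bundling it with shape and labels allows an
equality without casts, which can then be transported to the semantics. -/
theorem toLabelled_map {Λ' : Type v} (f : Λ → Λ') (D : Diagram Λ n) :
    (D.map f).toLabelled = ⟨D.Pos, D.finite_pos, D.bare, f ∘ D.label⟩ := by
  induction D with
  | comp D₂ D₁ ih₂ ih₁ =>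
    change LabelledDiagram.comp (D₂.map f).toLabelled (D₁.map f).toLabelled = _
    rw [ih₂, ih₁]
    exact congrArg (LabelledDiagram.mk _ _ _) (Sum.comp_elim f _ _).symm
  | par D₁ D₂ ih₁ ih₂ =>
    change LabelledDiagram.par (D₁.map f).toLabelled (D₂.map f).toLabelled = _
    rw [ih₁, ih₂]
    exact congrArg (LabelledDiagram.mk _ _ _) (Sum.comp_elim f _ _).symm
  | tr D ih =>
    change LabelledDiagram.tr (D.map f).toLabelled = _
    rw [ih]
    rfl
  | gate a => rfl
  | empty | wire | neg | swap | pbs =>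
    exact congrArg (LabelledDiagram.mk _ _ _) (funext fun x => Empty.elim x)

theorem toLabelled_deneg (D : Diagram Λ n) :
    D.deneg.toLabelled = ⟨D.Pos, D.finite_pos, D.bare.deneg, D.label⟩ := by
  induction D with
  | comp D₂ D₁ ih₂ ih₁ =>
    change LabelledDiagram.comp D₂.deneg.toLabelled D₁.deneg.toLabelled = _
    rw [ih₂, ih₁]
    exact congrArg (fun S => LabelledDiagram.mk (D₂.Pos ⊕ D₁.Pos) _ S _) (congrArg₂ Diagram.comp
      (deneg_map Sum.inl D₂.bare) (deneg_map Sum.inr D₁.bare)).symm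
  | par D₁ D₂ ih₁ ih₂ =>
    change LabelledDiagram.par D₁.deneg.toLabelled D₂.deneg.toLabelled = _
    rw [ih₁, ih₂]
    exact congrArg (fun S => LabelledDiagram.mk (D₁.Pos ⊕ D₂.Pos) _ S _) (congrArg₂ Diagram.par
      (deneg_map Sum.inl D₁.bare) (deneg_map Sum.inr D₂.bare)).symm
  | tr D ih =>
    change LabelledDiagram.tr D.deneg.toLabelled = _
    rw [ih]
    rfl
  | _ => rfl

end Diagram

/-! ### Contexts as diagrams -/

namespace Context

variable {Λ : Type w} {n : ℕ}

/-- The context as a diagram in which the hole carries the label `none`. -/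
def fill : {n : ℕ} → Context Λ n → Diagram (Option Λ) n
  | _, .hole => .gate none
  | _, .compLeft D C => .comp (D.map some) (fill C)
  | _, .compRight C D => .comp (fill C) (D.map some)
  | _, .parLeft D C => .par (D.map some) (fill C)
  | _, .parRight C D => .par (fill C) (D.map some)
  | _, .tr C => .tr (fill C)

/-- All fillings of a context become relabellings of one diagram, so they share occurrences, words
and targets; only the channel at the hole varies. -/
theorem subst_eq_map_fill (a : Λ) (C : Context Λ n) :
    C.subst a = C.fill.map fun o => o.getD a := by
  have h : ∀ {m : ℕ} (D : Diagram Λ m), (D.map some).map (fun o => o.getD a) = D := fun D => by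
    rw [Diagram.map_map]
    induction D <;> simp_all [Diagram.map]
  induction C <;> simp_all [subst, fill, Diagram.map]

theorem mult_fill [DecidableEq Λ] (C : Context Λ n) : C.fill.mult none = 1 := by
  have h : ∀ {m : ℕ} (D : Diagram Λ m), (D.map some).mult none = 0 := fun D =>
    Diagram.mult_map_eq_zero _ (fun b => Option.some_ne_none b) D
  induction C <;> simp_all [fill, Diagram.mult]

theorem negFree_fill (C : Context Λ n) : C.fill.NegFree ↔ C.NegFree := by
  induction C <;> simp_all [fill, NegFree, Diagram.NegFree, Diagram.negFree_map]

theorem pbsFree_fill (C : Context Λ n) : C.fill.PBSFree ↔ C.PBSFree := by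
  induction C <;> simp_all [fill, PBSFree, Diagram.PBSFree, Diagram.pbsFree_map]

/-- The context with wires in place of its polarisation flips. -/
def deneg : {n : ℕ} → Context Λ n → Context Λ n
  | _, .hole => .hole
  | _, .compLeft D C => .compLeft D.deneg (deneg C)
  | _, .compRight C D => .compRight (deneg C) D.deneg
  | _, .parLeft D C => .parLeft D.deneg (deneg C)
  | _, .parRight C D => .parRight (deneg C) D.deneg
  | _, .tr C => .tr (deneg C)

theorem negFree_deneg (C : Context Λ n) : C.deneg.NegFree := by
  induction C <;> simp_all [deneg, NegFree, Diagram.negFree_deneg]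

theorem subst_deneg (a : Λ) (C : Context Λ n) : C.deneg.subst a = (C.subst a).deneg := by
  induction C <;> simp_all [deneg, subst, Diagram.deneg]

end Context

/-! ### Equivalence relations and the semantics of filled contexts. -/

section Equivalences

variable {H : Type u} [NormedAddCommGroup H] [InnerProductSpace ℂ H]

theorem IsoLE.refl (P : PurifiedChannel.{u, v} H) : IsoLE P P := by
  have h : ∀ x : H ⊗[ℂ] P.E, (LinearIsometry.id : P.E →ₗᵢ[ℂ] P.E).lTensor H x = x := fun x => by
    rw [LinearIsometry.lTensor_apply]
    exact LinearMap.congr_fun (LinearMap.lTensor_id H P.E) x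
  exact ⟨LinearIsometry.id, rfl, fun x => by rw [h, h]⟩

theorem equivalence_isoEquiv :
    Equivalence (IsoEquiv : PurifiedChannel.{u, v} H → PurifiedChannel.{u, v} H → Prop) where
  refl P := .single (Or.inl (IsoLE.refl P))
  symm h := by
    induction h with
    | single h => exact .single (Or.symm h)
    | tail _ h ih => exact .head (Or.symm h) ih
  trans h k := h.trans k

/-- The action of a diagram on the polarisation of a particle entering at position `0`. -/
def polOp {ι : Type w} (D : Diagram ι 1) : Module.End ℂ (Particle H 1) :=
  TensorProduct.map (∑ c, ketbra (EuclideanSpace.single (D.target (c, 0)).1 (1 : ℂ))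
    (EuclideanSpace.single c (1 : ℂ))) LinearMap.id

theorem polOp_particleState {ι : Type w} (D : Diagram ι 1) (c : Pol) (h : H) :
    polOp D (particleState (c, 0) h) = particleState (D.target (c, 0)) h := by
  have h0 : (D.target (c, 0)).2 = 0 := Subsingleton.elim _ _
  simp only [polOp, particleState, TensorProduct.map_tmul, LinearMap.sum_apply, ketbra_apply,
    LinearMap.id_apply]
  rw [Finset.sum_eq_single c, h0]
  · simp
  · intro d _ hd
    rw [EuclideanSpace.inner_single_left]
    simp [hd]
  · simp

variable [FiniteDimensional ℂ H]

theorem equivalence_obsEquiv₂ :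
    Equivalence (ObsEquiv₂ : PurifiedChannel.{u, v} H → PurifiedChannel.{u, v} H → Prop) where
  refl _ _ := rfl
  symm h C := (h C).symm
  trans h k C := (h C).trans (k C)

theorem equivalence_obsEquiv₁ :
    Equivalence (ObsEquiv₁ : PurifiedChannel.{u, v} H → PurifiedChannel.{u, v} H → Prop) where
  refl _ _ _ := rfl
  symm h C hC := (h C hC).symm
  trans h k C hC := (h C hC).trans (k C hC)

theorem equivalence_obsEquiv₀ :
    Equivalence (ObsEquiv₀ : PurifiedChannel.{u, v} H → PurifiedChannel.{u, v} H → Prop) where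
  refl _ _ _ := rfl
  symm h C hC := (h C hC).symm
  trans h k C hC := (h C hC).trans (k C hC)

/-- The superoperator of a labelled diagram. -/
def LabelledDiagram.interp {n : ℕ} (L : LabelledDiagram (PurifiedChannel.{u, v} H) n) :
    Module.End ℂ (Particle H n) →ₗ[ℂ] Module.End ℂ (Particle H n) :=
  have := L.finite
  PBS.interp L.shape L.label

theorem semantics_eq_interp {n : ℕ} (D : Diagram (PurifiedChannel.{u, v} H) n) :
    semantics D = D.toLabelled.interp := rfl

theorem semantics_subst {n : ℕ} (C : Context (PurifiedChannel.{u, v} H) n)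
    (P : PurifiedChannel.{u, v} H) :
    semantics (C.subst P) = interp C.fill.bare fun i => (C.fill.label i).getD P := by
  rw [C.subst_eq_map_fill, semantics_eq_interp, Diagram.toLabelled_map]
  rfl

theorem semantics_subst_deneg {n : ℕ} (C : Context (PurifiedChannel.{u, v} H) n)
    (P : PurifiedChannel.{u, v} H) :
    semantics (C.deneg.subst P) =
      interp C.fill.bare.deneg fun i => (C.fill.label i).getD P := by
  rw [C.subst_deneg, C.subst_eq_map_fill, semantics_eq_interp, Diagram.toLabelled_deneg]
  -- The flips are removed by a function of the whole labelled diagram, so that `toLabelled_map` can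
  -- rewrite its argument.
  change LabelledDiagram.interp ((fun L : LabelledDiagram (PurifiedChannel.{u, v} H) n =>
    LabelledDiagram.mk L.Pos L.finite L.shape.deneg L.label) (Diagram.toLabelled _)) = _
  rw [Diagram.toLabelled_map]
  rfl

/-! ### The inclusions -/

/-- The given isometry is used at the hole and the identity at every other gate. -/
theorem IsoLE.obsEquiv₂ {P Q : PurifiedChannel.{u, v} H} (h : IsoLE P Q) : ObsEquiv₂ P Q := by
  intro C
  rw [semantics_subst, semantics_subst]
  refine interp_eq_of_isoLE _ fun i => ?_
  cases C.fill.label i with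
  | none => exact h
  | some R => exact IsoLE.refl R

theorem IsoEquiv.obsEquiv₂ {P Q : PurifiedChannel.{u, v} H} (h : IsoEquiv P Q) :
    ObsEquiv₂ P Q := by
  have hs : ∀ {P Q : PurifiedChannel.{u, v} H}, Relation.SymmGen IsoLE P Q → ObsEquiv₂ P Q :=
    fun h => h.elim IsoLE.obsEquiv₂ fun h => equivalence_obsEquiv₂.symm h.obsEquiv₂
  induction h with
  | single h => exact hs h
  | tail _ h ih => exact equivalence_obsEquiv₂.trans ih (hs h)

theorem ObsEquiv₂.obsEquiv₁ {P Q : PurifiedChannel.{u, v} H} (h : ObsEquiv₂ P Q) :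
    ObsEquiv₁ P Q := fun C _ => h C

/-- With a single wire, the flips only change the final polarisation, and this change can be
postponed until after all gates. -/
theorem diagramOp_eq_polOp_mul {ι : Type w} {D : Diagram ι 1} (hD : D.PBSFree)
    (G : ι → PurifiedChannel.{u, v} H) :
    diagramOp D G = (polOp D).rTensor (Env G) * diagramOp D.deneg G := by
  have hF : ∀ (c : Pol) (ξ : H ⊗[ℂ] Env G), (polOp D).rTensor (Env G) (atState (c, 0) _ ξ) =
      atState (D.target (c, 0)) _ ξ := fun c ξ => by
    induction ξ with
    | zero => simp
    | tmul h e => rw [atState_tmul, LinearMap.rTensor_tmul, polOp_particleState, atState_tmul]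
    | add ξ η hξ hη => simp only [map_add, hξ, hη]
  apply TensorProduct.ext'
  intro k x
  induction k using particleState_induction with
  | state s h =>
    obtain ⟨c, p⟩ := s
    obtain rfl : p = 0 := Subsingleton.elim _ _
    have ht : D.deneg.target (c, 0) = (c, 0) := by
      rw [hD.target_deneg c c 0]
      exact Prod.ext rfl (Subsingleton.elim _ _)
    rw [Module.End.mul_apply, diagramOp_particleState, diagramOp_particleState, ht, hF,
      hD.word_eq_word_deneg c c]
  | zero => simp
  | add y z hy hz => simp only [TensorProduct.add_tmul, map_add, hy, hz]

theorem Context.pbsFree_bare_fill {Λ : Type w} {n : ℕ} {C : Context Λ n} (hC : C.PBSFree) :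
    C.fill.bare.PBSFree := by
  rw [← Diagram.pbsFree_map C.fill.label, Diagram.bare_map_label]
  exact C.pbsFree_fill.2 hC

theorem ObsEquiv₁.obsEquiv₀ {P Q : PurifiedChannel.{u, v} H} (h : ObsEquiv₁ P Q) :
    ObsEquiv₀ P Q := by
  intro C hC
  have hD := Context.pbsFree_bare_fill hC
  -- The conjugating operator depends on the context but not on the channel `R` in the hole.
  have key : ∀ R : PurifiedChannel.{u, v} H, ∀ ρ, semantics (C.subst R) ρ =
      polOp C.fill.bare * semantics (C.deneg.subst R) ρ *
        LinearMap.adjoint (polOp C.fill.bare) := fun R ρ => by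
    rw [semantics_subst, semantics_subst_deneg, interp, interp, diagramOp_eq_polOp_mul hD,
      superoperator_rTensor_mul]
  ext1 ρ
  rw [key, key, h _ C.negFree_deneg]

/-! ### Changing the unitary of a purified channel -/

/-- The purified channel with another unitary. -/
abbrev PurifiedChannel.withU (P : PurifiedChannel.{u, v} H)
    (U : (H ⊗[ℂ] P.E) ≃ₗᵢ[ℂ] (H ⊗[ℂ] P.E)) : PurifiedChannel.{u, v} H :=
  ⟨P.E, P.ε, P.norm_ε, U⟩

variable {ι : Type w}

theorem wordOp_append (G : ι → PurifiedChannel.{u, v} H) (x y : List ι) :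
    wordOp G (x ++ y) = wordOp G y * wordOp G x := by
  induction x with
  | nil => simp [wordOp]
  | cons a x ih => rw [List.cons_append, wordOp, ih, wordOp, mul_assoc]

theorem wordOp_concat (G : ι → PurifiedChannel.{u, v} H) (x : List ι) (a : ι) :
    wordOp G (x ++ [a]) =
      gateOp (fun b => (G b).E) H a (G a).U.toLinearEquiv.toLinearMap * wordOp G x := by
  rw [wordOp_append]
  simp [wordOp]

open scoped Classical in
/-- If the gates in `S` act on their environments only, and each of them is crossed at most `N`
times, then the state reached along a path depends only on the orbits of length `N` of the initial
states of their environments. -/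
theorem wordOp_withU_apply_envState (G : ι → PurifiedChannel.{u, v} H)
    (U' : ∀ i, (H ⊗[ℂ] (G i).E) ≃ₗᵢ[ℂ] (H ⊗[ℂ] (G i).E)) (S : ι → Prop)
    (B B' : ∀ i, Module.End ℂ (G i).E) (N : ℕ) (hne : ∀ i, ¬ S i → U' i = (G i).U)
    (hB : ∀ i, S i → (G i).U.toLinearEquiv.toLinearMap = (B i).lTensor H)
    (hB' : ∀ i, S i → (U' i).toLinearEquiv.toLinearMap = (B' i).lTensor H)
    (hN : ∀ i, S i → ∀ k < N, B' i ((B i ^ k) (G i).ε) = B i ((B i ^ k) (G i).ε))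
    (x : List ι) (hx : ∀ i, S i → x.count i ≤ N) (h : H) :
    (wordOp (fun i => (G i).withU (U' i)) x (h ⊗ₜ[ℂ] envState G) : H ⊗[ℂ] Env G) =
        wordOp G x (h ⊗ₜ[ℂ] envState G) ∧
      wordOp G x (h ⊗ₜ[ℂ] envState G) ∈ Submodule.span ℂ
        {ξ : H ⊗[ℂ] Env G | ∃ (h : H) (y : ∀ i, (G i).E), ξ = h ⊗ₜ[ℂ] GlobalEnv.tprod y ∧
          ∀ i, S i → y i = (B i ^ x.count i) (G i).ε} := by
  induction x using List.reverseRecOn with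
  | nil => exact ⟨rfl, Submodule.subset_span ⟨h, fun i => (G i).ε, rfl, fun i _ => by simp⟩⟩
  | append_singleton x a ih =>
    have hcount : ∀ i, i ≠ a → (x ++ [a]).count i = x.count i := fun i hi => by
      simp [List.count_append, hi.symm]
    have hcount_self : (x ++ [a]).count a = x.count a + 1 := by simp [List.count_append]
    have hle : ∀ i, x.count i ≤ (x ++ [a]).count i := fun i => by simp [List.count_append]
    obtain ⟨heq, hmem⟩ := ih fun i hi => (hle i).trans (hx i hi)
    rw [wordOp_concat, wordOp_concat, Module.End.mul_apply, Module.End.mul_apply, heq]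
    -- Both claims are linear in the state reached so far, so generators of the span suffice. On
    -- these, the environments in `S` are at a known point of their orbits.
    generalize wordOp G x (h ⊗ₜ[ℂ] envState G) = ψ at hmem
    induction hmem using Submodule.span_induction with
    | zero => simp
    | add ξ η _ _ hξ hη =>
      rw [map_add, map_add, hξ.1, hη.1]
      exact ⟨rfl, Submodule.add_mem _ hξ.2 hη.2⟩
    | smul r ξ _ hξ =>
      rw [map_smul, map_smul, hξ.1]
      exact ⟨rfl, Submodule.smul_mem _ r hξ.2⟩
    | mem ξ hξ =>
      obtain ⟨h, y, rfl, hy⟩ := hξ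
      by_cases ha : S a
      · have hlt : x.count a < N := by
          have := hx a ha
          omega
        have h₁ : gateOp (fun b => (G b).E) H a (G a).U.toLinearEquiv.toLinearMap
            (h ⊗ₜ[ℂ] GlobalEnv.tprod y) =
            h ⊗ₜ[ℂ] GlobalEnv.tprod (Function.update y a (B a (y a))) := by
          rw [gateOp_tmul_tprod, hB a ha]
          simp
        have h₂ : gateOp (fun b => (G b).E) H a (U' a).toLinearEquiv.toLinearMap
            (h ⊗ₜ[ℂ] GlobalEnv.tprod y) =
            h ⊗ₜ[ℂ] GlobalEnv.tprod (Function.update y a (B' a (y a))) := by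
          rw [gateOp_tmul_tprod, hB' a ha]
          simp
        have h₃ : B' a (y a) = B a (y a) := by rw [hy a ha, hN a ha _ hlt]
        refine ⟨h₂.trans (by rw [h₁, h₃]), ?_⟩
        rw [h₁]
        refine Submodule.subset_span ⟨h, _, rfl, fun i hi => ?_⟩
        by_cases hia : i = a
        · subst hia
          rw [Function.update_self, hcount_self, pow_succ', Module.End.mul_apply, hy i hi]
        · rw [Function.update_of_ne hia, hcount i hia, hy i hi]
      · refine ⟨by simp only [hne a ha], ?_⟩
        rw [gateOp_tmul_tprod]
        -- A gate outside `S` may entangle the particle with its environment. This is why the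
        -- invariant is membership in a span and not a product form.
        generalize (G a).U.toLinearEquiv.toLinearMap (h ⊗ₜ[ℂ] y a) = η
        induction η with
        | zero => simp
        | tmul h e =>
          rw [insertEnv_tmul]
          refine Submodule.subset_span ⟨h, _, rfl, fun i hi => ?_⟩
          have hia : i ≠ a := fun hia => ha (hia ▸ hi)
          rw [Function.update_of_ne hia, hcount i hia, hy i hi]
        | add ξ η hξ hη => rw [map_add]; exact Submodule.add_mem _ hξ hη

theorem wordOp_withU_smul (G : ι → PurifiedChannel.{u, v} H)
    (U' : ∀ i, (H ⊗[ℂ] (G i).E) ≃ₗᵢ[ℂ] (H ⊗[ℂ] (G i).E)) (σ : ι → ℂ)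
    (hσ : ∀ i, (U' i).toLinearEquiv.toLinearMap = σ i • (G i).U.toLinearEquiv.toLinearMap)
    (x : List ι) (ξ : H ⊗[ℂ] Env G) :
    (wordOp (fun i => (G i).withU (U' i)) x ξ : H ⊗[ℂ] Env G) =
      (x.map σ).prod • wordOp G x ξ := by
  induction x generalizing ξ with
  | nil => simp [wordOp]
  | cons a x ih =>
    rw [wordOp, wordOp, Module.End.mul_apply, Module.End.mul_apply, ih]
    have : gateOp (fun b => (G b).E) H a (U' a).toLinearEquiv.toLinearMap ξ =
        σ a • gateOp (fun b => (G b).E) H a (G a).U.toLinearEquiv.toLinearMap ξ := by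
      rw [hσ, map_smul, LinearMap.smul_apply]
    refine (congrArg _ (congrArg _ this)).trans ?_
    rw [map_smul, List.map_cons, List.prod_cons, smul_smul, mul_comm]

/-! ### Channels that act on their environment only -/

variable {E : Type v} [NormedAddCommGroup E] [InnerProductSpace ℂ E] [FiniteDimensional ℂ E]

variable (H) in
/-- The purified channel `[I ⊗ A, |ε⟩, E]`. -/
abbrev localChannel (ε : E) (hε : ‖ε‖ = 1) (A : E ≃ₗᵢ[ℂ] E) : PurifiedChannel.{u, v} H :=
  ⟨E, ε, hε, A.lTensor H⟩

variable {ε : E} (hε : ‖ε‖ = 1) {A A' : E ≃ₗᵢ[ℂ] E}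

-- A context whose hole is crossed at most `N` times explores only the first `N` steps of the orbit
-- of `ε`.
open scoped Classical in
theorem semantics_subst_localChannel {N n : ℕ}
    (hN : ∀ k < N, A' ((A.toLinearEquiv.toLinearMap ^ k) ε) =
      A ((A.toLinearEquiv.toLinearMap ^ k) ε))
    (C : Context (PurifiedChannel.{u, v} H) n) (hC : ∀ s, (C.fill.word s).count none ≤ N) :
    semantics (C.subst (localChannel H ε hε A)) = semantics (C.subst (localChannel H ε hε A')) := by
  -- Defining the unitaries by cases on the label makes the two families differ by `withU` only, so
  -- their environments coincide definitionally. The value `0` of `B` on `some` is never used, as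
  -- only hole occurrences lie in `S`.
  let V : ∀ o : Option (PurifiedChannel.{u, v} H),
      (H ⊗[ℂ] (o.getD (localChannel H ε hε A)).E) ≃ₗᵢ[ℂ]
        (H ⊗[ℂ] (o.getD (localChannel H ε hε A)).E) := fun o =>
    match o with
    | none => A'.lTensor H
    | some R => R.U
  let B : (E ≃ₗᵢ[ℂ] E) → ∀ o : Option (PurifiedChannel.{u, v} H),
      Module.End ℂ (o.getD (localChannel H ε hε A)).E := fun T o =>
    match o with
    | none => T.toLinearEquiv.toLinearMap
    | some _ => 0
  have hV : ∀ o : Option (PurifiedChannel.{u, v} H), o.getD (localChannel H ε hε A') =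
      (o.getD (localChannel H ε hε A)).withU (V o) := fun o => by cases o <;> rfl
  rw [semantics_subst, semantics_subst]
  simp only [hV]
  refine interp_eq_of_isometry _ LinearIsometry.id fun s h => ?_
  -- Relabelling can only merge letters, so one occurrence is counted at most as often as the label
  -- `none`.
  have hcount : ∀ i, C.fill.label i = none → (C.fill.bare.word s).count i ≤ N := fun i hi => by
    refine (List.count_le_count_map (f := C.fill.label)).trans ?_
    rw [hi, ← Diagram.word_map, Diagram.bare_map_label]
    convert hC s
  refine (wordOp_withU_apply_envState (fun i => (C.fill.label i).getD (localChannel H ε hε A))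
    (fun i => V (C.fill.label i)) (fun i => C.fill.label i = none)
    (fun i => B A (C.fill.label i)) (fun i => B A' (C.fill.label i)) N
    ?_ ?_ ?_ ?_ _ hcount h).1.trans ?_
  · intro i
    generalize C.fill.label i = o
    cases o with
    | none => simp
    | some R => exact fun _ => rfl
  · intro i
    generalize C.fill.label i = o
    rintro rfl
    rfl
  · intro i
    generalize C.fill.label i = o
    rintro rfl
    rfl
  · intro i
    generalize C.fill.label i = o
    rintro rfl
    exact hN
  · exact (LinearMap.congr_fun (LinearMap.lTensor_id _ _) _).symm

theorem obsEquiv₂_localChannel (h₀ : A' ε = A ε) (h₁ : A' (A ε) = A (A ε)) :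
    ObsEquiv₂ (localChannel H ε hε A) (localChannel H ε hε A') := by
  classical
  intro C
  refine semantics_subst_localChannel hε (N := 2) (fun k hk => ?_) C fun s => ?_
  · interval_cases k
    · simpa using h₀
    · simpa using h₁
  · have := C.fill.count_word_le none s
    rw [C.mult_fill] at this
    convert this

theorem obsEquiv₁_localChannel (h₀ : A' ε = A ε) :
    ObsEquiv₁ (localChannel H ε hε A) (localChannel H ε hε A') := by
  classical
  intro C hC
  refine semantics_subst_localChannel hε (N := 1) (fun k hk => ?_) C fun s => ?_
  · interval_cases k
    simpa using h₀
  · have := (C.negFree_fill.2 hC).count_word_le none s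
    rw [C.mult_fill] at this
    convert this

/-- Each crossing of the hole contributes a factor `-1`. Without beam splitters both polarisations
cross the same word, so the product is a global phase. -/
theorem obsEquiv₀_localChannel_neg :
    ObsEquiv₀ (localChannel H ε hε A)
      (localChannel H ε hε (A.trans (LinearIsometryEquiv.neg ℂ))) := by
  intro C hC
  let V : ∀ o : Option (PurifiedChannel.{u, v} H),
      (H ⊗[ℂ] (o.getD (localChannel H ε hε A)).E) ≃ₗᵢ[ℂ]
        (H ⊗[ℂ] (o.getD (localChannel H ε hε A)).E) := fun o =>
    match o with
    | none => (A.trans (LinearIsometryEquiv.neg ℂ)).lTensor H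
    | some R => R.U
  let σ : Option (PurifiedChannel.{u, v} H) → ℂ := fun o =>
    match o with
    | none => -1
    | some _ => 1
  have hσ : ∀ o, ‖σ o‖ = 1 := fun o => by cases o <;> simp [σ]
  have hV : ∀ o : Option (PurifiedChannel.{u, v} H),
      o.getD (localChannel H ε hε (A.trans (LinearIsometryEquiv.neg ℂ))) =
      (o.getD (localChannel H ε hε A)).withU (V o) := fun o => by cases o <;> rfl
  rw [semantics_subst, semantics_subst]
  simp only [hV]
  have hc : ∀ x : List C.fill.Pos, ‖(x.map fun i => σ (C.fill.label i)).prod‖ = 1 := fun x => by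
    induction x with
    | nil => simp
    | cons a x ih => rw [List.map_cons, List.prod_cons, norm_mul, ih, hσ, one_mul]
  have hD := Context.pbsFree_bare_fill hC
  -- The choice of `.hor` is immaterial. The phase, of modulus one, serves as the isometry of the
  -- environment.
  let c : ℂ := ((C.fill.bare.deneg.word (.hor, 0)).map fun i => σ (C.fill.label i)).prod
  refine interp_eq_of_isometry _
    { toLinearMap := c • LinearMap.id
      norm_map' := fun x => by
        rw [LinearMap.smul_apply, norm_smul, hc, one_mul, LinearMap.id_apply] } fun s h => ?_
  have hs : C.fill.bare.word s = C.fill.bare.deneg.word (.hor, 0) := by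
    obtain ⟨d, p⟩ := s
    obtain rfl : p = 0 := Subsingleton.elim _ _
    exact hD.word_eq_word_deneg d .hor 0
  refine (wordOp_withU_smul (fun i => (C.fill.label i).getD (localChannel H ε hε A))
    (fun i => V (C.fill.label i)) (fun i => σ (C.fill.label i)) ?_ _ _).trans ?_
  · intro i
    generalize C.fill.label i = o
    cases o with
    | none =>
      refine TensorProduct.ext' fun h e => ?_
      change h ⊗ₜ[ℂ] (-(A e)) = (-1 : ℂ) • h ⊗ₜ[ℂ] A e
      simp [TensorProduct.tmul_neg]
    | some R => exact (one_smul ℂ _).symm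
  · rw [hs]
    change _ = (c • LinearMap.id).lTensor H _
    rw [LinearMap.lTensor_smul, LinearMap.lTensor_id]
    rfl

end Equivalences

/-! ### Two loops -/

namespace Diagram

variable {Λ : Type w}

/-- A vertical particle crosses the gate `a` once, a horizontal one does not cross it. -/
def loop (a : Λ) : Diagram Λ 1 :=
  .tr (n := 1) (.comp (.par .wire (.gate a)) .pbs)

/-- A vertical particle crosses the gate `a` twice, a horizontal one does not cross it. -/
def flipLoop (a : Λ) : Diagram Λ 1 :=
  .tr (n := 1) (.comp (.par .wire (.comp .neg (.gate a))) .pbs)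

theorem path_loop_hor (a : Λ) : Path (loop a) (.hor, 0) [] (.hor, 0) :=
  Or.inl ⟨[], (.hor, 0), [], ⟨rfl, rfl⟩, Or.inl ⟨0, 0, rfl, rfl, rfl, rfl⟩, rfl⟩

theorem path_loop_ver (a : Λ) : Path (loop a) (.ver, 0) [a] (.ver, 0) :=
  Or.inr (Or.inl ⟨[a], .ver, [],
    ⟨[], (.ver, 1), [a], ⟨rfl, rfl⟩, Or.inr ⟨0, 0, rfl, rfl, rfl, rfl⟩, rfl⟩,
    ⟨[], (.ver, 0), [], ⟨rfl, rfl⟩, Or.inl ⟨0, 0, rfl, rfl, rfl, rfl⟩, rfl⟩, rfl⟩)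

theorem path_flipLoop_hor (a : Λ) : Path (flipLoop a) (.hor, 0) [] (.hor, 0) :=
  Or.inl ⟨[], (.hor, 0), [], ⟨rfl, rfl⟩, Or.inl ⟨0, 0, rfl, rfl, rfl, rfl⟩, rfl⟩

/-- The beam splitter sends the vertical particle into the loop, where the gate is followed by a
flip. Now horizontal, it stays in the loop for a second round, becomes vertical again and is sent
out. -/
theorem path_flipLoop_ver (a : Λ) : Path (flipLoop a) (.ver, 0) [a, a] (.ver, 0) :=
  Or.inr (Or.inr ⟨[a], .hor, [a], .ver, [],
    ⟨[], (.ver, 1), [a], ⟨rfl, rfl⟩,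
      Or.inr ⟨0, 0, rfl, rfl, [a], (.ver, 0), [], ⟨rfl, rfl⟩, ⟨rfl, rfl⟩, rfl⟩, rfl⟩,
    ⟨[], (.hor, 1), [a], ⟨rfl, rfl⟩,
      Or.inr ⟨0, 0, rfl, rfl, [a], (.hor, 0), [], ⟨rfl, rfl⟩, ⟨rfl, rfl⟩, rfl⟩, rfl⟩,
    ⟨[], (.ver, 0), [], ⟨rfl, rfl⟩, Or.inl ⟨0, 0, rfl, rfl, rfl, rfl⟩, rfl⟩, rfl⟩)

/-- The only gate occurrence of `loop a`. -/
def loopPos (a : Λ) : (loop a).Pos := Sum.inl (Sum.inr ())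

/-- The only gate occurrence of `flipLoop a`. -/
def flipLoopPos (a : Λ) : (flipLoop a).Pos := Sum.inl (Sum.inr (Sum.inr ()))

theorem bare_loop (a : Λ) : (loop a).bare = loop (loopPos a) := rfl

theorem bare_flipLoop (a : Λ) : (flipLoop a).bare = flipLoop (flipLoopPos a) := rfl

end Diagram

/-! ### Interference experiments that read off overlaps of environment states. -/

section Interference

variable {H : Type u} [NormedAddCommGroup H] [InnerProductSpace ℂ H] [FiniteDimensional ℂ H]

open scoped Classical in
theorem wordOp_replicate {ι : Type w} (G : ι → PurifiedChannel.{u, v} H) (q : ι)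
    {B : Module.End ℂ (G q).E} (hB : (G q).U.toLinearEquiv.toLinearMap = B.lTensor H) (k : ℕ)
    (h : H) : wordOp G (List.replicate k q) (h ⊗ₜ[ℂ] envState G) =
      h ⊗ₜ[ℂ] GlobalEnv.tprod (Function.update (fun i => (G i).ε) q ((B ^ k) (G q).ε)) := by
  induction k with
  | zero => simp [wordOp, envState]
  | succ k ih =>
    rw [List.replicate_succ', wordOp_concat, Module.End.mul_apply, ih, gateOp_tmul_tprod, hB,
      pow_succ', Module.End.mul_apply]
    simp

/-- The interference term of the two polarisations, when a vertical particle crosses a gate acting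
on its environment `k` times and a horizontal one crosses no gate. -/
theorem semantics_ketbra {D : Diagram (PurifiedChannel.{u, v} H) 1} (q : D.Pos) (k : ℕ)
    (hhor : D.bare.Path (.hor, 0) [] (.hor, 0))
    (hver : D.bare.Path (.ver, 0) (List.replicate k q) (.ver, 0))
    {B : Module.End ℂ (D.label q).E}
    (hB : (D.label q).U.toLinearEquiv.toLinearMap = B.lTensor H) (h : H) :
    semantics D (ketbra (particleState (.ver, 0) h) (particleState (.hor, 0) h)) =
      (inner ℂ (D.label q).ε ((B ^ k) (D.label q).ε) : ℂ) •
        ketbra (particleState (.ver, 0) h) (particleState (.hor, 0) h) := by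
  classical
  have : Fintype D.Pos := Fintype.ofFinite _
  have hinner : inner ℂ (envState D.label) (GlobalEnv.tprod
      (Function.update (fun i => (D.label i).ε) q ((B ^ k) (D.label q).ε))) =
      (inner ℂ (D.label q).ε ((B ^ k) (D.label q).ε) : ℂ) := by
    -- Every untouched environment contributes `‖ε‖² = 1`.
    rw [envState, GlobalEnv.inner_tprod, Finset.prod_eq_single q]
    · rw [Function.update_self]
    · intro i _ hi
      rw [Function.update_of_ne hi, inner_self_eq_norm_sq_to_K, (D.label i).norm_ε]
      simp
    · simp
  rw [← hinner]
  refine superoperator_ketbra ?_ ?_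
  · rw [diagramOp_particleState, hver.word_eq, hver.target_eq, wordOp_replicate _ q hB,
      atState_tmul]
  · rw [diagramOp_particleState, hhor.word_eq, hhor.target_eq]
    exact atState_tmul _ _ _

variable {E : Type v} [NormedAddCommGroup E] [InnerProductSpace ℂ E] [FiniteDimensional ℂ E]

theorem semantics_ketbra_of_label {D : Diagram (PurifiedChannel.{u, v} H) 1} (q : D.Pos) (k : ℕ)
    (hhor : D.bare.Path (.hor, 0) [] (.hor, 0))
    (hver : D.bare.Path (.ver, 0) (List.replicate k q) (.ver, 0))
    {ε : E} {hε : ‖ε‖ = 1} {A : E ≃ₗᵢ[ℂ] E} (hq : D.label q = localChannel H ε hε A) (h : H) :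
    semantics D (ketbra (particleState (.ver, 0) h) (particleState (.hor, 0) h)) =
      (inner ℂ ε ((A.toLinearEquiv.toLinearMap ^ k) ε) : ℂ) •
        ketbra (particleState (.ver, 0) h) (particleState (.hor, 0) h) := by
  -- The space `(D.label q).E` depends on the label. Gathering everything in one existential
  -- statement lets `hq` be rewritten in all of it at once.
  have hB : ∃ B : Module.End ℂ (D.label q).E,
      (D.label q).U.toLinearEquiv.toLinearMap = B.lTensor H ∧
        (inner ℂ (D.label q).ε ((B ^ k) (D.label q).ε) : ℂ) =
          inner ℂ ε ((A.toLinearEquiv.toLinearMap ^ k) ε) := by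
    rw [hq]
    exact ⟨A.toLinearEquiv.toLinearMap, rfl, rfl⟩
  obtain ⟨B, hB, hk⟩ := hB
  rw [semantics_ketbra q k hhor hver hB, hk]

theorem semantics_loop_ketbra (ε : E) (hε : ‖ε‖ = 1) (A : E ≃ₗᵢ[ℂ] E) (x : H) :
    semantics (Diagram.loop (localChannel H ε hε A))
      (ketbra (particleState (.ver, 0) x) (particleState (.hor, 0) x)) =
      (inner ℂ ε (A ε) : ℂ) • ketbra (particleState (.ver, 0) x) (particleState (.hor, 0) x) := by
  have hhor := Diagram.path_loop_hor (Diagram.loopPos (localChannel H ε hε A))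
  have hver := Diagram.path_loop_ver (Diagram.loopPos (localChannel H ε hε A))
  rw [← Diagram.bare_loop] at hhor hver
  exact semantics_ketbra_of_label (Diagram.loopPos _) 1 hhor hver rfl x

theorem semantics_flipLoop_ketbra (ε : E) (hε : ‖ε‖ = 1) (A : E ≃ₗᵢ[ℂ] E) (x : H) :
    semantics (Diagram.flipLoop (localChannel H ε hε A))
      (ketbra (particleState (.ver, 0) x) (particleState (.hor, 0) x)) =
      (inner ℂ ε (A (A ε)) : ℂ) • ketbra (particleState (.ver, 0) x) (particleState (.hor, 0) x) := by
  have hhor := Diagram.path_flipLoop_hor (Diagram.flipLoopPos (localChannel H ε hε A))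
  have hver := Diagram.path_flipLoop_ver (Diagram.flipLoopPos (localChannel H ε hε A))
  rw [← Diagram.bare_flipLoop] at hhor hver
  exact semantics_ketbra_of_label (Diagram.flipLoopPos _) 2 hhor hver rfl x

variable [Nontrivial H]

/-- The loop without a flip is an admissible context, and its coherence coefficient is determined
because the operator it multiplies is nonzero; this uses a nonzero vector of `H`. -/
theorem inner_eq_of_obsEquiv₁ {ε : E} {hε : ‖ε‖ = 1} {A A' : E ≃ₗᵢ[ℂ] E}
    (h : ObsEquiv₁ (localChannel H ε hε A) (localChannel H ε hε A')) :
    (inner ℂ ε (A ε) : ℂ) = inner ℂ ε (A' ε) := by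
  obtain ⟨x, hx⟩ := exists_ne (0 : H)
  have hC : semantics (Diagram.loop (localChannel H ε hε A)) =
      semantics (Diagram.loop (localChannel H ε hε A')) :=
    h (.tr (n := 1) (.compRight (.parLeft .wire .hole) .pbs)) ⟨⟨trivial, trivial⟩, trivial⟩
  have hx' := semantics_loop_ketbra ε hε A x
  rw [hC, semantics_loop_ketbra] at hx'
  exact smul_left_injective ℂ (ketbra_ne_zero (particleState_ne_zero _ hx)
    (particleState_ne_zero _ hx)) hx'.symm

theorem inner_sq_eq_of_obsEquiv₂ {ε : E} {hε : ‖ε‖ = 1} {A A' : E ≃ₗᵢ[ℂ] E}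
    (h : ObsEquiv₂ (localChannel H ε hε A) (localChannel H ε hε A')) :
    (inner ℂ ε (A (A ε)) : ℂ) = inner ℂ ε (A' (A' ε)) := by
  obtain ⟨x, hx⟩ := exists_ne (0 : H)
  have hC : semantics (Diagram.flipLoop (localChannel H ε hε A)) =
      semantics (Diagram.flipLoop (localChannel H ε hε A')) :=
    h (.tr (n := 1) (.compRight (.parLeft .wire (.compLeft .neg .hole)) .pbs))
  have hx' := semantics_flipLoop_ketbra ε hε A x
  rw [hC, semantics_flipLoop_ketbra] at hx'
  exact smul_left_injective ℂ (ketbra_ne_zero (particleState_ne_zero _ hx)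
    (particleState_ne_zero _ hx)) hx'.symm

end Interference

/-! ### An invariant of isometry equivalence. -/

section Iso

variable {H : Type u} [NormedAddCommGroup H] [InnerProductSpace ℂ H]

/-- An isometry intertwining the unitaries and matching the initial states preserves matrix
coefficients of all powers. The third is the first that two crossings cannot reach. -/
theorem IsoEquiv.inner_cube_eq {P Q : PurifiedChannel.{u, v} H} (h : IsoEquiv P Q) (x : H) :
    (inner ℂ (x ⊗ₜ[ℂ] P.ε) (P.U (P.U (P.U (x ⊗ₜ[ℂ] P.ε)))) : ℂ) =
      inner ℂ (x ⊗ₜ[ℂ] Q.ε) (Q.U (Q.U (Q.U (x ⊗ₜ[ℂ] Q.ε)))) := by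
  have hle : ∀ {P Q : PurifiedChannel.{u, v} H}, IsoLE P Q →
      (inner ℂ (x ⊗ₜ[ℂ] P.ε) (P.U (P.U (P.U (x ⊗ₜ[ℂ] P.ε)))) : ℂ) =
        inner ℂ (x ⊗ₜ[ℂ] Q.ε) (Q.U (Q.U (Q.U (x ⊗ₜ[ℂ] Q.ε)))) := by
    rintro P Q ⟨W, hε, hU⟩
    have hx : W.lTensor H (x ⊗ₜ[ℂ] P.ε) = x ⊗ₜ[ℂ] Q.ε := by simp [hε]
    rw [← (W.lTensor H).inner_map_map, hU, hU, hU, hx]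
  induction h with
  | single h => exact h.elim hle fun h => (hle h).symm
  | tail _ h ih => exact ih.trans (h.elim hle fun h => (hle h).symm)

theorem inner_cube_eq_of_isoEquiv [Nontrivial H] {E : Type v} [NormedAddCommGroup E]
    [InnerProductSpace ℂ E] [FiniteDimensional ℂ E] {ε : E} {hε : ‖ε‖ = 1} {A A' : E ≃ₗᵢ[ℂ] E}
    (h : IsoEquiv (localChannel H ε hε A) (localChannel H ε hε A')) :
    (inner ℂ ε (A (A (A ε))) : ℂ) = inner ℂ ε (A' (A' (A' ε))) := by
  obtain ⟨x, hx⟩ := exists_ne (0 : H)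
  have := h.inner_cube_eq x
  simpa [hx] using this

end Iso

/-! ### Unitaries on `ℂ³` -/

/-- The unitary on a copy of `ℂ³` in a higher universe. -/
def liftOp (A : EuclideanSpace ℂ (Fin 3) ≃ₗᵢ[ℂ] EuclideanSpace ℂ (Fin 3)) :
    EuclideanSpace ℂ (ULift.{v} (Fin 3)) ≃ₗᵢ[ℂ] EuclideanSpace ℂ (ULift.{v} (Fin 3)) :=
  let e := LinearIsometryEquiv.piLpCongrLeft 2 ℂ ℂ (Equiv.ulift.{v} (α := Fin 3))
  e.trans (A.trans e.symm)

/-- The vector in a copy of `ℂ³` in a higher universe. -/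
def liftVec (x : EuclideanSpace ℂ (Fin 3)) : EuclideanSpace ℂ (ULift.{v} (Fin 3)) :=
  (LinearIsometryEquiv.piLpCongrLeft 2 ℂ ℂ (Equiv.ulift.{v} (α := Fin 3))).symm x

theorem liftOp_liftVec (A : EuclideanSpace ℂ (Fin 3) ≃ₗᵢ[ℂ] EuclideanSpace ℂ (Fin 3))
    (x : EuclideanSpace ℂ (Fin 3)) : liftOp.{v} A (liftVec x) = liftVec (A x) := by
  simp only [liftOp, liftVec, LinearIsometryEquiv.trans_apply,
    LinearIsometryEquiv.apply_symm_apply]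

theorem inner_liftVec (x y : EuclideanSpace ℂ (Fin 3)) :
    (inner ℂ (liftVec.{v} x) (liftVec y) : ℂ) = inner ℂ x y :=
  LinearIsometryEquiv.inner_map_map _ x y

theorem norm_liftVec_ket (x : Fin 3) : ‖liftVec.{v} (ket x)‖ = 1 :=
  (LinearIsometryEquiv.norm_map _ _).trans (by simp [ket])

theorem inner_ket (x y : Fin 3) : (inner ℂ (ket x) (ket y) : ℂ) = if x = y then 1 else 0 := by
  rw [ket, EuclideanSpace.inner_single_left]
  simp [ket]

/-- The exchange of `|0⟩` and `|2⟩`. -/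
def opSwap : EuclideanSpace ℂ (Fin 3) ≃ₗᵢ[ℂ] EuclideanSpace ℂ (Fin 3) :=
  LinearIsometryEquiv.piLpCongrLeft 2 ℂ ℂ (Equiv.swap 0 2)

theorem opSwap_ket (x : Fin 3) : opSwap (ket x) = ket (Equiv.swap 0 2 x) := by
  simp [opSwap, ket]

theorem opXN_ket_zero : (opN.trans opX) (ket 0) = ket 2 := by
  simp [opX_ket, opN_ket, show (-1 : Fin 3) = 2 from rfl]

theorem opXN_ket_two : (opN.trans opX) (ket 2) = ket 1 := by
  simp [opX_ket, opN_ket]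

theorem opXN_ket_one : (opN.trans opX) (ket 1) = -ket 0 := by
  simp [opX_ket, opN_ket]

theorem opX_ket_zero : opX (ket 0) = ket 2 := opX_ket 0

theorem opX_ket_two : opX (ket 2) = ket 1 := opX_ket 2

theorem opX_ket_one : opX (ket 1) = ket 0 := opX_ket 1

/-! ### Strictness of the inclusions. -/

section Strict

variable (H : Type u) [NormedAddCommGroup H] [InnerProductSpace ℂ H] [FiniteDimensional ℂ H]
  [Nontrivial H]

/-- The lifted channels of `X` and `XN` serve for any nonzero `H`: the return amplitude after three
steps is `1` for the first and `-1` for the second. -/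
theorem isoEquiv_lt_obsEquiv₂ :
    (IsoEquiv : PurifiedChannel.{u, v} H → PurifiedChannel.{u, v} H → Prop) < ObsEquiv₂ := by
  refine lt_of_le_not_ge (fun P Q h => h.obsEquiv₂) fun hle => ?_
  have := inner_cube_eq_of_isoEquiv (hle _ _ (obsEquiv₂_localChannel (H := H)
    (norm_liftVec_ket.{v} 0) (A := liftOp opX) (A' := liftOp (opN.trans opX))
    (by simp only [liftOp_liftVec, opX_ket_zero, opXN_ket_zero])
    (by simp only [liftOp_liftVec, opX_ket_zero, opX_ket_two, opXN_ket_two])))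
  simp only [liftOp_liftVec, inner_liftVec, opX_ket_zero, opX_ket_two, opX_ket_one, opXN_ket_zero,
    opXN_ket_two, opXN_ket_one, inner_neg_right, inner_ket] at this
  norm_num at this

/-- Both unitaries send `|0⟩` to `|2⟩`; a second step leads to `|1⟩` under `X` but back to `|0⟩`
under `opSwap`, giving overlaps `0` and `1`. -/
theorem obsEquiv₂_lt_obsEquiv₁ :
    (ObsEquiv₂ : PurifiedChannel.{u, v} H → PurifiedChannel.{u, v} H → Prop) < ObsEquiv₁ := by
  refine lt_of_le_not_ge (fun P Q h => h.obsEquiv₁) fun hle => ?_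
  have h0 : opSwap (ket 0) = ket 2 := by simp [opSwap_ket]
  have h2 : opSwap (ket 2) = ket 0 := by simp [opSwap_ket]
  have := inner_sq_eq_of_obsEquiv₂ (hle _ _ (obsEquiv₁_localChannel (H := H)
    (norm_liftVec_ket.{v} 0) (A := liftOp opX) (A' := liftOp opSwap)
    (by simp only [liftOp_liftVec, opX_ket_zero, h0])))
  simp only [liftOp_liftVec, inner_liftVec, opX_ket_zero, opX_ket_two, h0, h2, inner_ket] at this
  norm_num at this

/-- The identity and its negative have overlaps `1` and `-1` after one crossing. -/
theorem obsEquiv₁_lt_obsEquiv₀ :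
    (ObsEquiv₁ : PurifiedChannel.{u, v} H → PurifiedChannel.{u, v} H → Prop) < ObsEquiv₀ := by
  refine lt_of_le_not_ge (fun P Q h => h.obsEquiv₀) fun hle => ?_
  have := inner_eq_of_obsEquiv₁ (hle _ _ (obsEquiv₀_localChannel_neg (H := H)
    (norm_liftVec_ket.{v} 0) (A := LinearIsometryEquiv.refl ℂ _)))
  simp only [LinearIsometryEquiv.trans_apply, LinearIsometryEquiv.coe_refl, id_eq,
    LinearIsometryEquiv.coe_neg, inner_neg_right, inner_liftVec, inner_ket] at this
  norm_num at this

end Strict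

theorem qutritChannel_obsEquiv₂ :
    ObsEquiv₂ (qutritChannel opX) (qutritChannel (opN.trans opX)) :=
  obsEquiv₂_localChannel (H := ℂ) (ε := ket 0) _ (by rw [opX_ket_zero, opXN_ket_zero])
    (by rw [opX_ket_zero, opX_ket_two, opXN_ket_two])

theorem not_isoEquiv_qutritChannel :
    ¬ IsoEquiv (qutritChannel opX) (qutritChannel (opN.trans opX)) := by
  intro h
  have := inner_cube_eq_of_isoEquiv (H := ℂ) (ε := ket 0) h
  rw [opX_ket_zero, opX_ket_two, opX_ket_one, opXN_ket_zero, opXN_ket_two, opXN_ket_one,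
    inner_neg_right, inner_ket] at this
  norm_num at this

end

end PBS

theorem mainTheorem4 :
    (∀ (H : Type u) [NormedAddCommGroup H] [InnerProductSpace ℂ H] [FiniteDimensional ℂ H]
      [Nontrivial H],
      (Equivalence (PBS.IsoEquiv : PBS.PurifiedChannel.{u, v} H → _ → Prop) ∧
        Equivalence (PBS.ObsEquiv₂ : PBS.PurifiedChannel.{u, v} H → _ → Prop) ∧
        Equivalence (PBS.ObsEquiv₁ : PBS.PurifiedChannel.{u, v} H → _ → Prop) ∧
        Equivalence (PBS.ObsEquiv₀ : PBS.PurifiedChannel.{u, v} H → _ → Prop)) ∧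
      (PBS.IsoEquiv : PBS.PurifiedChannel.{u, v} H → _ → Prop) < PBS.ObsEquiv₂ ∧
      (PBS.ObsEquiv₂ : PBS.PurifiedChannel.{u, v} H → _ → Prop) < PBS.ObsEquiv₁ ∧
      (PBS.ObsEquiv₁ : PBS.PurifiedChannel.{u, v} H → _ → Prop) < PBS.ObsEquiv₀) ∧
    PBS.ObsEquiv₂ (PBS.qutritChannel PBS.opX) (PBS.qutritChannel (PBS.opN.trans PBS.opX)) ∧
    ¬ PBS.IsoEquiv (PBS.qutritChannel PBS.opX)
      (PBS.qutritChannel (PBS.opN.trans PBS.opX)) :=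
  ⟨fun H _ _ _ _ => ⟨⟨PBS.equivalence_isoEquiv, PBS.equivalence_obsEquiv₂,
      PBS.equivalence_obsEquiv₁, PBS.equivalence_obsEquiv₀⟩,
    PBS.isoEquiv_lt_obsEquiv₂ H, PBS.obsEquiv₂_lt_obsEquiv₁ H, PBS.obsEquiv₁_lt_obsEquiv₀ H⟩,
    PBS.qutritChannel_obsEquiv₂, PBS.not_isoEquiv_qutritChannel⟩
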